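/- **Setting.** An input of size $n$ of online matching on the line consists of servers $s_1\le\dots\le s_n$ in $\mathbb R$, known in advance, and requests $r_1,\dots,r_n\in\mathbb R$, which arrive one by one; each request is matched on arrival to an unmatched server, at a cost equal to their distance. $\mathrm{OPT}$ is the least total cost of a perfect matching. A (possibly randomized) online algorithm $\mathrm A$ is $c(n)$-competitive with additive constant $\alpha$ if on every input of every size $n$ its (expected) cost is at most $c(n)\cdot\mathrm{OPT}+\alpha$. An online algorithm with advice may in addition read bits, one after the other, from an infinite tape written by an oracle that knows the whole input. **Algorithm $\mathrm{LR}$** serves a request $r$ as follows: match $r$ to an unmatched server at $r$ if there is one; otherwise, if all unmatched servers are greater (less) than $r$, to the least (greatest) of them; otherwise read a bit, and match $r$ to the greatest unmatched server less than $r$ if it is $0$, and to the least unmatched server greater than $r$ if it is $1$. **Algorithm $\mathrm{DIVIDE}_k$** ($1\le k\le n$, with subroutine $\mathrm A$), for inputs with $s_1=1$, $s_n=N-1$, $N\in\mathbb Z^+$, and $r_i\in\mathbb Z$ for all $i$. Split the servers, in increasing order, into consecutive blocks $S_1,\dots,S_k$, the first $n \bmod k$ of size $\lceil n/k\rceil$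 and the others of size $\lfloor n/k\rfloor$. Let $p_i=\frac12(\max S_i+\min S_{i+1})$ for $1\le i<k$, $p_0=-\infty$, $p_k=\infty$, and $B_i=(p_{i-1},p_i]$ (with $B_k=(p_{k-1},\infty)$). Below, let $\pi$ be an optimal matching with $\pi(i)<\pi(j)$ whenever $r_i<r_j$; the pair of $r_i$ is $s_{\pi(i)}$, and the position of a request $r$ means $\max(0,\min(N,r))$. *Advice.* Positions are written with $\lfloor\log_2N\rfloor+1$ bits and numbers of requests with $\lfloor\log_2 n\rfloor+1$ bits. The algorithm reads, for $i=2,\dots,k$, the position $q_{i,L}$ of the rightmost request in $B_i$ whose pair is in some $S_j$, $j<i$ ($0$ if there is none); for $i=1,\dots,k-1$, the position $q_{i,R}$ of the leftmost request in $B_i$ whose pair is in some $S_j$, $j>i$ (the all-ones word if there is none); for $i=1,\dots,k-1$, unless $q_{i,R}$ is the all-ones word, the number $d_{i,R}$ of requests in $B_i$ at position $q_{i,R}$ with pairs in $S_i$ and the number $m_{i,R}$ of requests in $B_i$ with pairs in $\bigcup_{j>i}S_j$; for $i=k,\dots,2$, if $q_{i,L}>0$, the number $d_{i,L}$ of requests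 in $B_i$ at position $q_{i,L}$ with pairs in $\bigcup_{j\ge i}S_j$ and the number $m_{i,L}$ of requests in $B_i$ with pairs in $\bigcup_{j<i}S_j$. (Numbers not read are $0$.) *Marking servers.* For $i=1,\dots,k-1$ mark the $m_{i,R}$ consecutive servers that begin with the first server of $\bigcup_{j>i}S_j$ not yet marked in this procedure. Independently, for $i=k,\dots,2$ mark the $m_{i,L}$ consecutive servers that end with the last server of $\bigcup_{j<i}S_j$ not yet marked in this second procedure. *Serving a request* $r\in B_j$ at position $y$. If $j>1$ and either $y<q_{j,L}$, or $y=q_{j,L}$ and at least $d_{j,L}$ earlier requests at position $y$ were not marked left, mark $r$ left. Otherwise, if $j<k$ and either $y>q_{j,R}$, or $y=q_{j,R}$ and at least $d_{j,R}$ earlier requests at position $y$ were left unmarked, mark $r$ right. Otherwise leave $r$ unmarked. An unmarked request in $B_j$ is served by $\mathrm A$, run on the unmarked servers of $S_j$ and the unmarked requests in $B_j$. A marked request is served by $\mathrm{LR}$, run on the marked servers and the marked requests, where $\mathrm{LR}$, if it reads a bit for this request, gets $0$ for a request marked left and $1$ for one marked right. **Theorem.** There is an absolute constant $C$ such that the following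 holds for every integer $k\ge1$. Let $\mathrm A$ be a (deterministic or randomized) online matching algorithm on the line that is $c(n)$-competitive with additive constant $\alpha$, where $c(n)$ is nondecreasing in $n\ge1$. Then, on every input of size $n\ge k$ with $s_1=1$, $s_n=N-1$, $N\in\mathbb Z^+$, and all $r_i\in\mathbb Z$: 1. $\mathrm{DIVIDE}_k$ reads at most $C\,k\,(\log_2N+\log_2n)$ bits, whatever is written on the advice tape; 2. there is an advice tape, depending on the input but not on the random choices of $\mathrm A$, for which $\mathrm{DIVIDE}_k$ outputs a perfect matching whose (expected) cost is at most $c(\lceil n/k\rceil)\cdot\mathrm{OPT}+k\alpha$. That is, $\mathrm{DIVIDE}_k$ is $c(\lceil n/k\rceil)$-competitive and reads $O(k(\log N+\log n))$ bits of advice. -/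

import Mathlib

/-! Online minimum matching on the line.  An input of size `n` is a nondecreasing list `s` of `n`
server positions and a list `r` of `n` request positions, in order of arrival.  Servers are referred
to by their index in the list `s` (counted from `0`). -/

noncomputable section

namespace LineMatching

/-- `(s, r)` is an input: the servers are sorted and there are as many requests as servers. -/
def IsInput (s r : List ℝ) : Prop :=
  s.Pairwise (· ≤ ·) ∧ r.length = s.length

/-- A list of server indices (the server of the first request, of the second one, ...) is a perfect
matching if it is a permutation of all `n` server indices. -/
def IsMatching (n : ℕ) (σ : List ℕ) : Prop :=
  σ.Perm (List.range n)

/-- Total distance between the requests `r` and the servers `σ` assigned to them. -/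
def cost (s r : List ℝ) (σ : List ℕ) : ℝ :=
  (List.zipWith (fun x j => |x - s.getD j 0|) r σ).sum

/-- The optimal (offline) cost: the least cost of a perfect matching. -/
def opt (s r : List ℝ) : ℝ :=
  sInf {x | ∃ σ, IsMatching s.length σ ∧ x = cost s r σ}

/-- The outcome of serving the requests `r` one by one, where `serve s past x` is the index of the
server assigned to the current request `x` after the requests `past` (in order of arrival). -/
def runServe (serve : List ℝ → List ℝ → ℝ → ℕ) (s r : List ℝ) : List ℕ :=
  r.mapIdx (fun i x => serve s (r.take i) x)

/-- A deterministic online matching algorithm (without advice): every request is assigned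
irrevocably on the basis of the servers, the earlier requests and the request itself, and no server
is used twice. -/
structure OnlineAlg where
  serve : List ℝ → List ℝ → ℝ → ℕ
  legal : ∀ s r, IsInput s r → IsMatching s.length (runServe serve s r)

/-- The matching produced by an online algorithm. -/
def OnlineAlg.run (A : OnlineAlg) (s r : List ℝ) : List ℕ :=
  runServe A.serve s r

open MeasureTheory in
/-- A randomized online algorithm is a family of deterministic ones indexed by the points of a
probability space, every decision being a random variable.  (A deterministic algorithm is the case
of a one-point space.) -/
def IsRandomized {Ω : Type*} [MeasurableSpace Ω] (A : Ω → OnlineAlg) : Prop :=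
  ∀ (s past : List ℝ) (x : ℝ), past.length < s.length →
    Measurable (fun ω => (A ω).serve s past x)

open MeasureTheory in
/-- `A` is `c(n)`-competitive with additive constant `α`: its (expected) cost on every input of size
`n` is at most `c n` times the optimal cost plus `α`. -/
def IsCompetitive {Ω : Type*} [MeasurableSpace Ω] (μ : Measure Ω) (A : Ω → OnlineAlg)
    (c : ℕ → ℝ) (α : ℝ) : Prop :=
  ∀ s r, IsInput s r → ∫ ω, cost s r ((A ω).run s r) ∂μ ≤ c s.length * opt s r + α

/-! ### The tape model of advice -/

/-- A computation that may read bits from the advice tape, one after the other. -/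
inductive BitReader (β : Type) : Type
  | done (b : β) : BitReader β
  | read (next : Bool → BitReader β) : BitReader β

namespace BitReader

def bind {β γ : Type} : BitReader β → (β → BitReader γ) → BitReader γ
  | done b, f => f b
  | read next, f => read (fun b => (next b).bind f)

instance : Monad BitReader where
  pure := done
  bind := bind

/-- The result of the computation on an infinite tape. -/
def eval {β : Type} : BitReader β → (ℕ → Bool) → β
  | done b, _ => b
  | read next, t => (next (t 0)).eval (fun i => t (i + 1))

/-- The number of bits that the computation reads from the tape. -/
def bits {β : Type} : BitReader β → (ℕ → Bool) → ℕ
  | done _, _ => 0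
  | read next, t => (next (t 0)).bits (fun i => t (i + 1)) + 1

/-- Read one bit. -/
def bit : BitReader Bool := read done

/-- Read a word of `w` bits, as a binary number (most significant bit first). -/
def word : ℕ → BitReader ℕ
  | 0 => pure 0
  | w + 1 => do
    let b ← bit
    let x ← word w
    pure (b.toNat * 2 ^ w + x)

/-- Perform `f i` for each `i` of the list, in this order, and return the table of results. -/
def table {β : Type} (dflt : β) (f : ℕ → BitReader β) : List ℕ → BitReader (ℕ → β)
  | [] => pure (fun _ => dflt)
  | i :: l => do
    let x ← f i
    let g ← table dflt f l
    pure (Function.update g i x)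

end BitReader

/-- An online matching algorithm with advice: it sees the servers, then the requests one by one;
it assigns each request before it sees the next one, and may read bits of the advice tape at any
time. -/
structure AdviceAlg where
  State : Type
  init : List ℝ → BitReader State
  step : State → ℝ → BitReader (State × ℕ)

/-- Serve the requests of a list from a given state. -/
def AdviceAlg.serveFrom (D : AdviceAlg) : D.State → List ℝ → BitReader (List ℕ)
  | _, [] => pure []
  | st, x :: l => do
    let (st', j) ← D.step st x
    let σ ← D.serveFrom st' l
    pure (j :: σ)

/-- The whole computation on servers `s` and requests `r`; the result is the list of the servers
assigned to the requests. -/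
def AdviceAlg.run (D : AdviceAlg) (s r : List ℝ) : BitReader (List ℕ) := do
  let st ← D.init s
  D.serveFrom st r

/-! ### Algorithm LR -/

/-- Least element (junk value `0` for the empty set). -/
def least (F : Finset ℕ) : ℕ := F.min.untopD 0

/-- Greatest element (junk value `0` for the empty set). -/
def greatest (F : Finset ℕ) : ℕ := F.max.unbotD 0

/-- How algorithm LR serves a request at `x` when `free` is the set of the unmatched servers.  As
the servers are sorted, the least server is the one of least index. -/
def lrServe (s : List ℝ) (free : Finset ℕ) (x : ℝ) : BitReader ℕ :=
  let equal := free.filter (fun j => s.getD j 0 = x)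
  let smaller := free.filter (fun j => s.getD j 0 < x)
  let greater := free.filter (fun j => x < s.getD j 0)
  if equal.Nonempty then pure (least equal)
  else if smaller = ∅ then pure (least greater)
  else if greater = ∅ then pure (greatest smaller)
  else do
    let b ← BitReader.bit
    pure (if b then least greater else greatest smaller)

/-! ### Algorithm DIVIDE

Blocks are numbered `1, ..., k`.  In the comments, `π` is an optimal matching with
`π(i) < π(j)` whenever `r_i < r_j`, the pair of `r_i` is its partner under `π`, and positions of
requests are truncated to the interval `[0, N]`. -/

/-- The number of servers in the first `i` blocks, when `n` servers are divided into `k` blocks of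
which the first `n % k` have size `⌈n/k⌉` and the others have size `⌊n/k⌋`. -/
def blockEnd (n k i : ℕ) : ℕ := i * (n / k) + min i (n % k)

/-- The border `p_i` between block `i` and block `i + 1`: the midpoint of the last server of block
`i` and the first server of block `i + 1`. -/
def border (s : List ℝ) (k i : ℕ) : ℝ :=
  (s.getD (blockEnd s.length k i - 1) 0 + s.getD (blockEnd s.length k i) 0) / 2

/-- The number `j` of the block `B_j` that contains `x`, where `B_1 = (-∞, p_1]`,
`B_j = (p_{j-1}, p_j]` for `1 < j < k` and `B_k = (p_{k-1}, ∞)`. -/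
def blockOf (s : List ℝ) (k : ℕ) (x : ℝ) : ℕ :=
  ((List.range' 1 (k - 1)).find? (fun i => decide (x ≤ border s k i))).getD k

/-- The number `N` with `s_n = N - 1`. -/
def span (s : List ℝ) : ℕ := ⌊s.getLastD 0⌋₊ + 1

/-- Truncation of a position to `[0, N]`. -/
def trunc (s : List ℝ) (x : ℝ) : ℝ := max 0 (min (span s : ℝ) x)

/-- The data that DIVIDE reads from the advice tape.

* `qL i` is the position of the rightmost request of `B_i` whose pair lies in an earlier block, and
  `0` if there is none;
* `qR i` is the position of the leftmost request of `B_i` whose pair lies in a later block, and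
  the all-ones word if there is none;
* `dR i` is the number of requests in `B_i` at position `qR i` whose pairs are in `S_i`;
* `mR i` is the number of requests in `B_i` whose pairs lie in later blocks;
* `dL i` is the number of requests in `B_i` at position `qL i` whose pairs are not in an earlier
  block;
* `mL i` is the number of requests in `B_i` whose pairs lie in earlier blocks. -/
structure DivideAdvice where
  qL : ℕ → ℕ
  qR : ℕ → ℕ
  dR : ℕ → ℕ
  mR : ℕ → ℕ
  dL : ℕ → ℕ
  mL : ℕ → ℕ

/-- Reading the advice.  Positions are words of `⌊log₂ N⌋ + 1` bits, numbers of requests are words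
of `⌊log₂ n⌋ + 1` bits; the latter are read only for the blocks where there is such a request. -/
def readAdvice (s : List ℝ) (k : ℕ) : BitReader DivideAdvice := do
  let wN := Nat.log 2 (span s) + 1
  let wn := Nat.log 2 s.length + 1
  let pair : BitReader (ℕ × ℕ) := do
    let d ← BitReader.word wn
    let m ← BitReader.word wn
    pure (d, m)
  let qL ← BitReader.table 0 (fun _ => BitReader.word wN) (List.range' 2 (k - 1))
  let qR ← BitReader.table 0 (fun _ => BitReader.word wN) (List.range' 1 (k - 1))
  let dmR ← BitReader.table (0, 0) (fun i => if qR i ≠ 2 ^ wN - 1 then pair else pure (0, 0))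
    (List.range' 1 (k - 1))
  let dmL ← BitReader.table (0, 0) (fun i => if 0 < qL i then pair else pure (0, 0))
    (List.range' 2 (k - 1)).reverse
  pure { qL := qL, qR := qR, dR := fun i => (dmR i).1, mR := fun i => (dmR i).2,
         dL := fun i => (dmL i).1, mL := fun i => (dmL i).2 }

/-- First marking procedure: for `i = 1, ..., k - 1`, mark `mR i` consecutive servers, beginning
with the first server of the blocks after block `i` that is not yet marked. -/
def markRight (s : List ℝ) (k : ℕ) (a : DivideAdvice) : Finset ℕ :=
  (List.range' 1 (k - 1)).foldl (fun M i =>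
    let j := least (Finset.Ico (blockEnd s.length k i) s.length \ M)
    M ∪ Finset.Ico j (j + a.mR i)) ∅

/-- Second marking procedure: for `i = k, ..., 2`, mark `mL i` consecutive servers, going down from
the last server of the blocks before block `i` that is not yet marked. -/
def markLeft (s : List ℝ) (k : ℕ) (a : DivideAdvice) : Finset ℕ :=
  (List.range' 2 (k - 1)).reverse.foldl (fun M i =>
    let j := greatest (Finset.range (blockEnd s.length k (i - 1)) \ M)
    M ∪ Finset.Ico (j + 1 - a.mL i) (j + 1)) ∅

/-- The marked servers. -/
def marked (s : List ℝ) (k : ℕ) (a : DivideAdvice) : Finset ℕ :=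
  markRight s k a ∪ markLeft s k a

/-- A request is left unmarked (and is served inside its block), or it is marked as a request that
is to be served to the left or to the right. -/
inductive Label
  | inside
  | left
  | right
  deriving DecidableEq

/-- A request that has been served: its position, its label and its server. -/
structure Served where
  pos : ℝ
  label : Label
  server : ℕ

/-- The label of a request at `x`, given the requests served before. -/
def labelOf (s : List ℝ) (k : ℕ) (a : DivideAdvice) (log : List Served) (x : ℝ) : Label :=
  let j := blockOf s k x
  let y := trunc s x
  let same := log.filter (fun e => decide (trunc s e.pos = y))
  if 1 < j ∧ (y < a.qL j ∨
      (y = a.qL j ∧ a.dL j ≤ (same.filter (fun e => e.label ≠ Label.left)).length)) then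
    Label.left
  else if j < k ∧ (a.qR j < y ∨
      (y = a.qR j ∧ a.dR j ≤ (same.filter (fun e => e.label = Label.inside)).length)) then
    Label.right
  else Label.inside

/-- Serving an unmarked request at `x`: run `A` on the unmarked servers and the unmarked requests
of the block of `x`. -/
def serveInside (A : OnlineAlg) (s : List ℝ) (k : ℕ) (a : DivideAdvice) (log : List Served)
    (x : ℝ) : ℕ :=
  let j := blockOf s k x
  let servers := (List.range s.length).filter (fun i =>
    decide (blockEnd s.length k (j - 1) ≤ i ∧ i < blockEnd s.length k j ∧ i ∉ marked s k a))
  let past := (log.filter (fun e =>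
    decide (e.label = Label.inside ∧ blockOf s k e.pos = j))).map Served.pos
  servers.getD (A.serve (servers.map (fun i => s.getD i 0)) past x) 0

/-- Serving a marked request at `x`: run LR on the marked servers and the marked requests, with the
bit `b` on its advice tape (`b = true` for a request marked `right`). -/
def serveMarked (s : List ℝ) (k : ℕ) (a : DivideAdvice) (log : List Served)
    (b : Bool) (x : ℝ) : ℕ :=
  (lrServe s (marked s k a \ (log.map Served.server).toFinset) x).eval (fun _ => b)

/-- How DIVIDE serves a request at `x` (without reading further bits of its own tape). -/
def divideServe (A : OnlineAlg) (s : List ℝ) (k : ℕ) (a : DivideAdvice) (log : List Served)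
    (x : ℝ) : ℕ :=
  match labelOf s k a log x with
  | Label.inside => serveInside A s k a log x
  | Label.left => serveMarked s k a log false x
  | Label.right => serveMarked s k a log true x

/-- The state of DIVIDE: the servers, the advice read, and the requests served, in order of
arrival. -/
structure DivideState where
  servers : List ℝ
  advice : DivideAdvice
  log : List Served

/-- Algorithm `DIVIDE_k` with subroutine `A`. -/
def divide (k : ℕ) (A : OnlineAlg) : AdviceAlg where
  State := DivideState
  init s := do
    let a ← readAdvice s k
    pure { servers := s, advice := a, log := [] }
  step st x :=
    let j := divideServe A st.servers k st.advice st.log x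
    let e : Served :=
      { pos := x, label := labelOf st.servers k st.advice st.log x, server := j }
    pure ({ st with log := st.log ++ [e] }, j)

end LineMatching

end

/-! All servers lie in `[1, N - 1]`, so truncating the requests to `[0, N]` changes the cost of
every matching by the same amount. By the usual exchange argument, a matching is therefore optimal
as soon as it sorts the truncated requests (`sum_le_opt`). Let `ys` be their sorted list, its `t`-th
entry being paired with server `t`, and label this entry left, right or inside according to whether
server `t` belongs to an earlier block than the request, a later one, or the same one.

Blocks of requests are intervals of positions and blocks of servers are intervals of indices. So
along `ys` the requests of one block are labelled left, then inside, then right, and two threshold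
positions together with the counts at them determine how many requests at each position carry each
label (`labelOf_eq`). For the same reason the marking procedures find exactly the pairs of the
requests labelled left or right (`mem_marked_iff`). Which of several requests at one truncated
position receives which label is immaterial, since such requests may trade partners. DIVIDE hands
out at each position first the inside labels, then the right ones, then the left ones, in the
correct numbers (`count_labelLog`); hence some optimal matching `Z` carries exactly its labels
(`exists_matching_labelLog`). Labels do not depend on `A`, so one tape and one `Z` serve all random
choices.

On the marked requests nothing is lost. Each time, LR picks a free server `u` weakly between the
request and its partner `t`; passing `t` on to the later owner of `u` keeps both the total cost and
the correctness of the directions (`IsDirected.swap`), so LR pays what `Z` pays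
(`lrRun_perm_and_cost`). On the unmarked requests of a block, `Z` restricts to a perfect matching of
the input given to `A`, which has at most `⌈n/k⌉` servers, so `A` pays at most `c ⌈n/k⌉` times the
cost of `Z` there, plus `α`. Summing over the blocks proves the cost bound, because `c ≥ 1` for
every competitive algorithm (`IsCompetitive.one_le`). The bound on the bits is a count of the words
read; serving requests reads none. -/

noncomputable section

namespace LineMatching

/-! ### Bits read and values attained by computations on a tape -/

namespace BitReader

theorem bits_bind_le {β γ : Type} {p : BitReader β} {f : β → BitReader γ} {a b : ℕ}
    (hp : ∀ t, p.bits t ≤ a) (hf : ∀ v t, (f v).bits t ≤ b) (t : ℕ → Bool) :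
    (p >>= f).bits t ≤ a + b := by
  change (p.bind f).bits t ≤ a + b
  induction p generalizing a t with
  | done v => exact (hf v t).trans (Nat.le_add_left _ _)
  | read next ih =>
    obtain ⟨a, rfl⟩ : ∃ a', a = a' + 1 := by
      have := hp t
      simp only [bits] at this
      exact ⟨a - 1, by omega⟩
    have h : ∀ t', (next (t 0)).bits t' ≤ a := fun t' => by
      -- The bound for `next (t 0)` on an arbitrary tape `t'` comes from the tape with the bit `t 0`
      -- put in front of `t'`.
      have := hp (fun i => Nat.casesOn i (t 0) t')
      simpa [bits] using this
    have := ih (t 0) h (fun i => t (i + 1))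
    simp only [bind, bits]
    omega

theorem bits_pure_le {β : Type} (v : β) (t : ℕ → Bool) : (pure v : BitReader β).bits t ≤ 0 :=
  le_refl 0

theorem eval_pure {β : Type} (v : β) (t : ℕ → Bool) : (pure v : BitReader β).eval t = v :=
  rfl

/-- The values that a computation can take on some tape. -/
def CanOutput {β : Type} (p : BitReader β) (v : β) : Prop := ∃ t, p.eval t = v

theorem canOutput_pure {β : Type} (v : β) : CanOutput (pure v) v := ⟨fun _ => false, rfl⟩

/-- A computation reads only a finite prefix of its tape, so a tape for `f v` can be placed right
behind the bits read by `p`. In this way the advice tape is obtained piece by piece without being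
written out. -/
theorem CanOutput.bind {β γ : Type} {p : BitReader β} {f : β → BitReader γ} {v : β} {u : γ}
    (hp : CanOutput p v) (hf : CanOutput (f v) u) : CanOutput (p >>= f) u := by
  change CanOutput (p.bind f) u
  obtain ⟨t, ht⟩ := hp
  induction p generalizing t with
  | done w =>
    simp only [eval] at ht
    subst ht
    exact hf
  | read next ih =>
    obtain ⟨t', ht'⟩ := ih (t 0) (fun i => t (i + 1)) ht
    refine ⟨fun i => Nat.casesOn i (t 0) t', ?_⟩
    simp only [BitReader.bind, eval]
    exact ht'

theorem canOutput_bit (b : Bool) : CanOutput bit b := ⟨fun _ => b, rfl⟩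

theorem bits_bit_le (t : ℕ → Bool) : bit.bits t ≤ 1 := le_refl 1

theorem canOutput_word {w x : ℕ} (hx : x < 2 ^ w) : CanOutput (word w) x := by
  induction w generalizing x with
  | zero =>
    obtain rfl : x = 0 := by simpa using hx
    exact canOutput_pure 0
  | succ w ih =>
    have hp := pow_succ 2 w
    by_cases h : x < 2 ^ w
    · refine (canOutput_bit false).bind ((ih h).bind ?_)
      simpa using canOutput_pure x
    · refine (canOutput_bit true).bind ((ih (x := x - 2 ^ w) (by omega)).bind ?_)
      have : x = true.toNat * 2 ^ w + (x - 2 ^ w) := by simp; omega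
      exact this ▸ canOutput_pure x

theorem bits_word_le (w : ℕ) (t : ℕ → Bool) : (word w).bits t ≤ w := by
  induction w generalizing t with
  | zero => exact bits_pure_le _ _
  | succ w ih =>
    have := bits_bind_le bits_bit_le (fun b => bits_bind_le ih
      (f := fun x => (pure (b.toNat * 2 ^ w + x) : BitReader ℕ)) fun _ => bits_pure_le _) t
    exact this.trans (by omega)

theorem canOutput_table {β : Type} (dflt : β) {f : ℕ → BitReader β} {v : ℕ → β} {l : List ℕ}
    (h : ∀ i ∈ l, CanOutput (f i) (v i)) :
    CanOutput (table dflt f l) (fun i => if i ∈ l then v i else dflt) := by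
  induction l with
  | nil => simpa [table] using canOutput_pure (fun _ : ℕ => dflt)
  | cons i l ih =>
    refine (h i (by simp)).bind ((ih fun j hj => h j (by simp [hj])).bind ?_)
    convert canOutput_pure _ using 1
    funext j
    by_cases hj : j = i
    · subst hj; simp
    · simp [hj]

theorem bits_table_le {β : Type} (dflt : β) {f : ℕ → BitReader β} {a : ℕ}
    (h : ∀ i t, (f i).bits t ≤ a) (l : List ℕ) (t : ℕ → Bool) :
    (table dflt f l).bits t ≤ l.length * a := by
  induction l generalizing t with
  | nil => exact (bits_pure_le _ t).trans (Nat.zero_le _)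
  | cons i l ih =>
    have := bits_bind_le (h i) (fun x => bits_bind_le ih
      (f := fun g => (pure (Function.update g i x) : BitReader (ℕ → β)))
        fun _ => bits_pure_le _) t
    refine this.trans (le_of_eq ?_)
    simp
    ring

end BitReader

/-! ### Length of the advice, and tapes that produce prescribed advice -/

open BitReader

theorem bits_readAdvice_le (s : List ℝ) (k : ℕ) (t : ℕ → Bool) :
    (readAdvice s k).bits t ≤
      (k - 1) * (2 * (Nat.log 2 (span s) + 1) + 4 * (Nat.log 2 s.length + 1)) := by
  unfold readAdvice
  have hw := fun w => bits_word_le w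
  have hpair : ∀ w t, (do
      let d ← word w
      let m ← word w
      pure (d, m) : BitReader (ℕ × ℕ)).bits t ≤ w + w := fun w t =>
    bits_bind_le (hw w) (fun d => bits_bind_le (hw w) (b := 0) fun _ => bits_pure_le _) t
  refine (bits_bind_le (bits_table_le 0 (fun _ => hw _) _)
    (fun qL => bits_bind_le (bits_table_le 0 (fun _ => hw _) _)
    (fun qR => bits_bind_le (bits_table_le (0, 0)
      (a := (Nat.log 2 s.length + 1) + (Nat.log 2 s.length + 1)) (fun i t => ?_) _)
    (fun dmR => bits_bind_le (bits_table_le (0, 0)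
      (a := (Nat.log 2 s.length + 1) + (Nat.log 2 s.length + 1)) (fun i t => ?_) _)
    (fun dmL => bits_pure_le _)))) t).trans ?_
  · split_ifs
    · exact hpair _ t
    · exact (bits_pure_le _ t).trans (Nat.zero_le _)
  · split_ifs
    · exact hpair _ t
    · exact (bits_pure_le _ t).trans (Nat.zero_le _)
  · simp only [List.length_range', List.length_reverse]
    apply le_of_eq
    ring

/-- Every table of words of the right lengths can be written on the advice tape. -/
theorem exists_tape_readAdvice (s : List ℝ) (k : ℕ) (b : DivideAdvice)
    (hqL : ∀ i, b.qL i < 2 ^ (Nat.log 2 (span s) + 1))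
    (hqR : ∀ i, b.qR i < 2 ^ (Nat.log 2 (span s) + 1))
    (hdR : ∀ i, b.dR i < 2 ^ (Nat.log 2 s.length + 1))
    (hmR : ∀ i, b.mR i < 2 ^ (Nat.log 2 s.length + 1))
    (hdL : ∀ i, b.dL i < 2 ^ (Nat.log 2 s.length + 1))
    (hmL : ∀ i, b.mL i < 2 ^ (Nat.log 2 s.length + 1)) :
    ∃ (t : ℕ → Bool) (a : DivideAdvice), (readAdvice s k).eval t = a ∧
      (∀ i, 1 < i → i ≤ k → a.qL i = b.qL i ∧ (0 < b.qL i → a.dL i = b.dL i ∧ a.mL i = b.mL i) ∧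
        (b.qL i = 0 → a.mL i = 0)) ∧
      (∀ i, 0 < i → i < k → a.qR i = b.qR i ∧
        (b.qR i ≠ 2 ^ (Nat.log 2 (span s) + 1) - 1 → a.dR i = b.dR i ∧ a.mR i = b.mR i) ∧
        (b.qR i = 2 ^ (Nat.log 2 (span s) + 1) - 1 → a.mR i = 0)) := by
  set wN := Nat.log 2 (span s) + 1 with hwN
  set wn := Nat.log 2 s.length + 1 with hwn
  have hpair : ∀ d m, d < 2 ^ wn → m < 2 ^ wn → CanOutput (do
      let d ← word wn
      let m ← word wn
      pure (d, m) : BitReader (ℕ × ℕ)) (d, m) := fun d m hd hm =>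
    (canOutput_word hd).bind ((canOutput_word hm).bind (canOutput_pure _))
  have key : ∀ a, a = ({
      qL := fun i => if i ∈ List.range' 2 (k - 1) then b.qL i else 0
      qR := fun i => if i ∈ List.range' 1 (k - 1) then b.qR i else 0
      dR := fun i => (if i ∈ List.range' 1 (k - 1) then
        (if b.qR i ≠ 2 ^ wN - 1 then (b.dR i, b.mR i) else (0, 0)) else (0, 0)).1
      mR := fun i => (if i ∈ List.range' 1 (k - 1) then
        (if b.qR i ≠ 2 ^ wN - 1 then (b.dR i, b.mR i) else (0, 0)) else (0, 0)).2
      dL := fun i => (if i ∈ (List.range' 2 (k - 1)).reverse then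
        (if 0 < b.qL i then (b.dL i, b.mL i) else (0, 0)) else (0, 0)).1
      mL := fun i => (if i ∈ (List.range' 2 (k - 1)).reverse then
        (if 0 < b.qL i then (b.dL i, b.mL i) else (0, 0)) else (0, 0)).2 } : DivideAdvice) →
      CanOutput (readAdvice s k) a := by
    rintro a rfl
    unfold readAdvice
    refine (canOutput_table 0 (fun i _ => canOutput_word (hqL i))).bind
      ((canOutput_table 0 (fun i _ => canOutput_word (hqR i))).bind
      ((canOutput_table (0, 0) (fun i hi => ?_)).bind
      ((canOutput_table (0, 0) (fun i hi => ?_)).bind (canOutput_pure _))))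
    · simp only [hi, if_true]
      by_cases h : b.qR i ≠ 2 ^ wN - 1
      · simp only [h, if_true, ← hwN, ne_eq, not_false_eq_true]
        exact hpair _ _ (hdR i) (hmR i)
      · simp only [h, if_false, ← hwN]
        exact canOutput_pure _
    · simp only [List.mem_reverse] at hi
      simp only [hi, if_true]
      by_cases h : 0 < b.qL i
      · simp only [h, if_true]
        exact hpair _ _ (hdL i) (hmL i)
      · simp only [h, if_false]
        exact canOutput_pure _
  obtain ⟨t, ht⟩ := key _ rfl
  refine ⟨t, _, ht, fun i hi hk => ?_, fun i hi hk => ?_⟩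
  · have hm : i ∈ List.range' 2 (k - 1) := by rw [List.mem_range'_1]; omega
    simp only [List.mem_reverse, hm, if_true, true_and]
    exact ⟨fun h => by simp [h], fun h => by simp [h]⟩
  · have hm : i ∈ List.range' 1 (k - 1) := by rw [List.mem_range'_1]; omega
    simp only [hm, if_true, true_and]
    exact ⟨fun h => by simp [h], fun h => by simp [h]⟩

/-! ### Lists -/

/-- A rearrangement of the images lifts to one of the list; entries with the same image may be
chosen in any order. This is what lets requests at the same position trade partners. -/
theorem exists_perm_map_eq {α β : Type*} {f : α → β} {l₁ : List β} {l₂ : List α}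
    (h : l₁.Perm (l₂.map f)) : ∃ l₃ : List α, l₃.Perm l₂ ∧ l₃.map f = l₁ := by
  generalize hl : l₂.map f = l at h
  induction h generalizing l₂ with
  | nil => exact ⟨[], by simpa using hl, rfl⟩
  | cons x _ ih =>
    cases l₂ with
    | nil => simp at hl
    | cons a l₂ =>
      simp only [List.map_cons, List.cons.injEq] at hl
      obtain ⟨l₃, h₁, h₂⟩ := ih hl.2
      exact ⟨a :: l₃, h₁.cons a, by simp [hl.1, h₂]⟩
  | swap x y l =>
    rcases l₂ with _ | ⟨a, _ | ⟨b, l₂⟩⟩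
    · simp at hl
    · simp at hl
    · simp only [List.map_cons, List.cons.injEq] at hl
      exact ⟨b :: a :: l₂, List.Perm.swap _ _ _, by simp [hl]⟩
  | trans _ _ ih₁ ih₂ =>
    obtain ⟨l₃, h₁, h₂⟩ := ih₂ hl
    obtain ⟨l₄, h₃, h₄⟩ := ih₁ h₂
    exact ⟨l₄, h₃.trans h₁, h₄⟩

theorem abs_sub_add_abs_sub_le {x y a b : ℝ} (hxy : x ≤ y) (hab : a ≤ b) :
    |x - a| + |y - b| ≤ |x - b| + |y - a| := by
  rcases abs_cases (x - a) with h | h <;> rcases abs_cases (y - b) with h' | h' <;>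
  rcases abs_cases (x - b) with h'' | h'' <;> rcases abs_cases (y - a) with h''' | h''' <;>
  linarith

/-- Among all the matchings of two sorted lists, the sorted one has the least cost. -/
theorem sum_abs_sub_sorted_le {l : List (ℝ × ℝ)} {ss : List ℝ}
    (hl : (l.map Prod.fst).Pairwise (· ≤ ·)) (hs : ss.Pairwise (· ≤ ·))
    (h : (l.map Prod.snd).Perm ss) :
    (List.zipWith (fun x a => |x - a|) (l.map Prod.fst) ss).sum ≤
      (l.map fun p => |p.1 - p.2|).sum := by
  induction ss generalizing l with
  | nil =>
    have : l = [] := by simpa using h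
    simp [this]
  | cons a ss ih =>
    rcases l with _ | ⟨⟨x, b⟩, l⟩
    · simp at h
    · simp only [List.map_cons, List.pairwise_cons] at hl hs h
      by_cases hab : b = a
      · subst hab
        have := ih hl.2 hs.2 (List.perm_cons _ |>.1 h)
        simpa using this
      · have ha : a ∈ l.map Prod.snd := by
          have : a ∈ b :: l.map Prod.snd := h.mem_iff.2 (by simp)
          simpa [Ne.symm hab] using this
        obtain ⟨⟨y, a'⟩, hy, rfl⟩ := List.mem_map.1 ha
        obtain ⟨l₁, l₂, rfl⟩ := List.append_of_mem hy
        have hb : b ∈ ss := by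
          have : b ∈ a' :: ss := h.mem_iff.1 (by simp)
          simpa [hab] using this
        have hp : ((l₁ ++ (y, b) :: l₂).map Prod.snd).Perm ss := by
          have h1 : (b :: (l₁ ++ (y, a') :: l₂).map Prod.snd).Perm
              (a' :: (l₁ ++ (y, b) :: l₂).map Prod.snd) := by
            simp only [List.map_append, List.map_cons]
            calc _ = (b :: l₁.map Prod.snd) ++ a' :: l₂.map Prod.snd := rfl
              _ |>.Perm (a' :: ((b :: l₁.map Prod.snd) ++ l₂.map Prod.snd)) := List.perm_middle
              _ |>.Perm _ := (List.perm_middle.symm).cons a'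
          exact (List.perm_cons _).1 (h1.symm.trans h)
        have hm : (l₁ ++ (y, a') :: l₂).map Prod.fst = (l₁ ++ (y, b) :: l₂).map Prod.fst := by simp
        have := ih (l := l₁ ++ (y, b) :: l₂) (hm ▸ hl.2) hs.2 hp
        have h2 := abs_sub_add_abs_sub_le (hl.1 y (by simp)) (hs.1 b hb)
        rw [← hm] at this
        simp only [List.map_append, List.map_cons, List.sum_append, List.sum_cons,
          List.zipWith_cons_cons] at this ⊢
        linarith

/-- Splitting a sum over a list according to a label and a block number. -/
theorem sum_map_eq_sum_blocks {α M : Type*} [AddCommMonoid M] (l : List α) (f : α → M)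
    (p : α → Prop) [DecidablePred p] (b : α → ℕ) (k : ℕ) (hb : ∀ a ∈ l, b a ∈ Finset.Icc 1 k) :
    (l.map f).sum = ∑ j ∈ Finset.Icc 1 k, ((l.filter fun a => decide (p a ∧ b a = j)).map f).sum +
      ((l.filter fun a => decide (¬ p a)).map f).sum := by
  induction l with
  | nil => simp
  | cons a l ih =>
    rw [List.map_cons, List.sum_cons, ih fun c hc => hb c (by simp [hc])]
    by_cases hp : p a
    · have : ∀ j, (((a :: l).filter fun a => decide (p a ∧ b a = j)).map f).sum =
          (if b a = j then f a else 0) +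
            ((l.filter fun a => decide (p a ∧ b a = j)).map f).sum := by
        intro j
        by_cases h : b a = j <;> simp [hp, h]
      simp only [this, Finset.sum_add_distrib, Finset.sum_ite_eq, hb a (by simp), if_true]
      simp [hp, add_assoc]
    · simp [hp, add_left_comm]

/-! ### Least and greatest elements -/

theorem least_eq {F : Finset ℕ} {j : ℕ} (hj : j ∈ F) (h : ∀ i ∈ F, j ≤ i) : least F = j := by
  have : F.min = (j : WithTop ℕ) :=
    le_antisymm (Finset.min_le hj) (Finset.le_min fun i hi => WithTop.coe_le_coe.2 (h i hi))
  rw [least, this]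
  rfl

theorem greatest_eq {F : Finset ℕ} {j : ℕ} (hj : j ∈ F) (h : ∀ i ∈ F, i ≤ j) :
    greatest F = j := by
  have : F.max = (j : WithBot ℕ) :=
    le_antisymm (Finset.max_le fun i hi => WithBot.coe_le_coe.2 (h i hi)) (Finset.le_max hj)
  rw [greatest, this]
  rfl

theorem least_mem {F : Finset ℕ} (hF : F.Nonempty) : least F ∈ F ∧ ∀ i ∈ F, least F ≤ i := by
  rw [least_eq (F.min'_mem hF) fun i hi => F.min'_le i hi]
  exact ⟨F.min'_mem hF, fun i hi => F.min'_le i hi⟩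

theorem greatest_mem {F : Finset ℕ} (hF : F.Nonempty) :
    greatest F ∈ F ∧ ∀ i ∈ F, i ≤ greatest F := by
  rw [greatest_eq (F.max'_mem hF) fun i hi => F.le_max' i hi]
  exact ⟨F.max'_mem hF, fun i hi => F.le_max' i hi⟩

/-! ### Algorithm LR with the advice of a monotone matching -/

theorem getD_le_getD {s : List ℝ} (hs : s.Pairwise (· ≤ ·)) {i j : ℕ} (hij : i ≤ j)
    (hj : j < s.length) : s.getD i 0 ≤ s.getD j 0 := by
  rw [List.getD_eq_getElem _ _ hj, List.getD_eq_getElem _ _ (hij.trans_lt hj)]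
  rcases hij.eq_or_lt with rfl | h
  · exact le_rfl
  · exact List.pairwise_iff_getElem.1 hs i j _ _ h

/-- LR with bit `0` takes a server that is at least as close as any free server to the left. -/
theorem lrServe_left {s : List ℝ} (hs : s.Pairwise (· ≤ ·)) {F : Finset ℕ}
    (hF : ∀ j ∈ F, j < s.length) {x : ℝ} {t : ℕ} (ht : t ∈ F) (hx : s.getD t 0 < x) :
    (lrServe s F x).eval (fun _ => false) ∈ F ∧
      s.getD t 0 ≤ s.getD ((lrServe s F x).eval (fun _ => false)) 0 ∧
      s.getD ((lrServe s F x).eval (fun _ => false)) 0 ≤ x := by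
  have hne : (F.filter fun j => s.getD j 0 < x).Nonempty := ⟨t, Finset.mem_filter.2 ⟨ht, hx⟩⟩
  have hg := greatest_mem hne
  have hg1 := Finset.mem_filter.1 hg.1
  have hfin : greatest (F.filter fun j => s.getD j 0 < x) ∈ F ∧
      s.getD t 0 ≤ s.getD (greatest (F.filter fun j => s.getD j 0 < x)) 0 ∧
      s.getD (greatest (F.filter fun j => s.getD j 0 < x)) 0 ≤ x :=
    ⟨hg1.1, getD_le_getD hs (hg.2 t (Finset.mem_filter.2 ⟨ht, hx⟩)) (hF _ hg1.1), hg1.2.le⟩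
  unfold lrServe
  by_cases h1 : (F.filter fun j => s.getD j 0 = x).Nonempty
  · have := Finset.mem_filter.1 (least_mem h1).1
    simp only [h1, if_true, BitReader.eval_pure]
    exact ⟨this.1, by rw [this.2]; exact hx.le, this.2.le⟩
  · simp only [h1, if_false, hne.ne_empty]
    split_ifs
    · exact hfin
    · exact hfin

/-- LR with bit `1` takes a server that is at least as close as any free server to the right. -/
theorem lrServe_right {s : List ℝ} (hs : s.Pairwise (· ≤ ·)) {F : Finset ℕ}
    (hF : ∀ j ∈ F, j < s.length) {x : ℝ} {t : ℕ} (ht : t ∈ F) (hx : x ≤ s.getD t 0) :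
    (lrServe s F x).eval (fun _ => true) ∈ F ∧
      x ≤ s.getD ((lrServe s F x).eval (fun _ => true)) 0 ∧
      s.getD ((lrServe s F x).eval (fun _ => true)) 0 ≤ s.getD t 0 := by
  unfold lrServe
  by_cases h1 : (F.filter fun j => s.getD j 0 = x).Nonempty
  · have := Finset.mem_filter.1 (least_mem h1).1
    simp only [h1, if_true, BitReader.eval_pure]
    exact ⟨this.1, this.2.ge, by rw [this.2]; exact hx⟩
  · have hx' : x < s.getD t 0 := lt_of_le_of_ne hx fun h => h1 ⟨t, by simp [ht, h]⟩
    have hne : (F.filter fun j => x < s.getD j 0).Nonempty := ⟨t, by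
      rw [Finset.mem_filter]; exact ⟨ht, hx'⟩⟩
    have hg := least_mem hne
    have hg1 := Finset.mem_filter.1 hg.1
    have hfin : least (F.filter fun j => x < s.getD j 0) ∈ F ∧
        x ≤ s.getD (least (F.filter fun j => x < s.getD j 0)) 0 ∧
        s.getD (least (F.filter fun j => x < s.getD j 0)) 0 ≤ s.getD t 0 :=
      ⟨hg1.1, hg1.2.le, getD_le_getD hs (hg.2 t (by
        rw [Finset.mem_filter]; exact ⟨ht, hx'⟩)) (hF _ ht)⟩
    simp only [h1, if_false, hne.ne_empty]
    split_ifs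
    · exact hfin
    · exact hfin

/-- The servers that LR assigns to a list of requests, each of them given with the advice bit. -/
def lrRun (s : List ℝ) : Finset ℕ → List (ℝ × Bool) → List ℕ
  | _, [] => []
  | F, q :: l =>
    let u := (lrServe s F q.1).eval (fun _ => q.2)
    u :: lrRun s (F.erase u) l

/-- A list of requests with advice bits and partners such that the advice bits tell on which side
the partner lies, the matching is monotone on pairs with different bits, and no request with bit `1`
comes after a request with bit `0` at the same place. -/
structure IsDirected (s : List ℝ) (l : List ((ℝ × Bool) × ℕ)) : Prop where
  left : ∀ e ∈ l, e.1.2 = false → s.getD e.2 0 < e.1.1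
  right : ∀ e ∈ l, e.1.2 = true → e.1.1 ≤ s.getD e.2 0
  mono : ∀ e ∈ l, ∀ e' ∈ l, e.1.2 = true → e'.1.2 = false → e.1.1 < e'.1.1 →
    s.getD e.2 0 ≤ s.getD e'.2 0
  order : (l.map Prod.fst).Pairwise fun q q' => q.2 = false → q'.2 = true → q.1 ≠ q'.1

theorem IsDirected.tail {s : List ℝ} {e : (ℝ × Bool) × ℕ} {l : List ((ℝ × Bool) × ℕ)}
    (h : IsDirected s (e :: l)) : IsDirected s l where
  left e he := h.left e (by simp [he])
  right e he := h.right e (by simp [he])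
  mono e he e' he' := h.mono e (by simp [he]) e' (by simp [he'])
  order := by have := h.order; simp only [List.map_cons, List.pairwise_cons] at this; exact this.2

/-- Handing the partner `u` of a later request to the first one. -/
theorem IsDirected.swap {s : List ℝ} {q q' : ℝ × Bool} {t u : ℕ} {l₁ l₂ : List ((ℝ × Bool) × ℕ)}
    (h : IsDirected s ((q, t) :: (l₁ ++ (q', u) :: l₂)))
    (hl : q.2 = false → s.getD t 0 ≤ s.getD u 0 ∧ s.getD u 0 ≤ q.1)
    (hr : q.2 = true → q.1 ≤ s.getD u 0 ∧ s.getD u 0 ≤ s.getD t 0) :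
    IsDirected s (l₁ ++ (q', t) :: l₂) ∧
      |q.1 - s.getD u 0| + |q'.1 - s.getD t 0| = |q.1 - s.getD t 0| + |q'.1 - s.getD u 0| := by
  have hT := h.tail
  have hm : ∀ e ∈ l₁ ++ (q', t) :: l₂, e ∈ l₁ ++ (q', u) :: l₂ ∨ e = (q', t) := by
    intro e he
    simp only [List.mem_append, List.mem_cons] at he ⊢
    tauto
  have hmem : (q', u) ∈ l₁ ++ (q', u) :: l₂ := by simp
  have hord : ((l₁ ++ (q', t) :: l₂).map Prod.fst).Pairwise
      fun q q' => q.2 = false → q'.2 = true → q.1 ≠ q'.1 := by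
    have := hT.order
    simp only [List.map_append, List.map_cons] at this ⊢
    exact this
  have hK : ∀ e ∈ l₁ ++ (q', u) :: l₂, q.2 = false → e.1.2 = true → q.1 ≠ e.1.1 := by
    have := h.order
    rw [List.map_cons, List.pairwise_cons] at this
    exact fun e he => this.1 e.1 (List.mem_map_of_mem he)
  -- Exchanging two servers at the same place affects neither directions nor costs. Exchanges
  -- between requests of opposite directions all turn out to be of this kind.
  have same : s.getD t 0 = s.getD u 0 → IsDirected s (l₁ ++ (q', t) :: l₂) ∧
      |q.1 - s.getD u 0| + |q'.1 - s.getD t 0| = |q.1 - s.getD t 0| + |q'.1 - s.getD u 0| := by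
    intro hu
    refine ⟨⟨?_, ?_, ?_, hord⟩, by rw [hu]⟩
    · intro e he hb
      rcases hm e he with he | rfl
      · exact hT.left e he hb
      · exact hu ▸ hT.left _ hmem hb
    · intro e he hb
      rcases hm e he with he | rfl
      · exact hT.right e he hb
      · exact hu ▸ hT.right _ hmem hb
    · intro e he e' he' hb hb' hlt
      rcases hm e he with he | rfl <;> rcases hm e' he' with he' | rfl
      · exact hT.mono e he e' he' hb hb' hlt
      · exact hu ▸ hT.mono e he _ hmem hb hb' hlt
      · exact hu ▸ hT.mono _ hmem e' he' hb hb' hlt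
      · exact le_rfl
  have hq : ((q, t) : (ℝ × Bool) × ℕ) ∈ (q, t) :: (l₁ ++ (q', u) :: l₂) := by simp
  have hq' : ((q', u) : (ℝ × Bool) × ℕ) ∈ (q, t) :: (l₁ ++ (q', u) :: l₂) := by simp
  have hin : ∀ e ∈ l₁ ++ (q', u) :: l₂, e ∈ (q, t) :: (l₁ ++ (q', u) :: l₂) :=
    fun e he => List.mem_cons_of_mem _ he
  obtain ⟨x, b⟩ := q
  obtain ⟨x', b'⟩ := q'
  cases b with
  | false =>
    obtain ⟨h1, h2⟩ := hl rfl
    have hx := h.left _ hq rfl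
    simp only at h1 h2 hx
    cases b' with
    | true =>
      have h3 := h.right _ hq' rfl
      have h4 := hK _ hmem rfl rfl
      simp only at h3 h4
      -- If `x' < x`, monotonicity forces `t` and `u` to the same place; equality is excluded by
      -- `order`, and `x < x'` contradicts that `u` lies between `x'` and `x`.
      rcases lt_trichotomy x' x with h5 | h5 | h5
      · exact same (le_antisymm h1 (h.mono _ hq' _ hq rfl rfl h5))
      · exact absurd h5.symm h4
      · linarith
    | false =>
      have h3 := h.left _ hq' rfl
      simp only at h3
      refine ⟨⟨?_, ?_, ?_, hord⟩, ?_⟩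
      · intro e he hb
        rcases hm e he with he | rfl
        · exact hT.left e he hb
        · exact h1.trans_lt h3
      · intro e he hb
        rcases hm e he with he | rfl
        · exact hT.right e he hb
        · simp at hb
      · intro e he e' he' hb hb' hlt
        rcases hm e he with he | rfl
        · rcases hm e' he' with he' | rfl
          · exact hT.mono e he e' he' hb hb' hlt
          -- A request going right from before `x` was already compared with the pair of `x`; one at
          -- `x` is excluded by `order`; one from beyond `x` has its server beyond `u`, against
          -- monotonicity with the old pair of `q'`.
          · rcases lt_trichotomy e.1.1 x with h5 | h5 | h5
            · exact h.mono e (hin e he) ((x, false), t) hq hb rfl h5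
            · exact absurd h5.symm (hK e he rfl hb)
            · have := hT.mono e he _ hmem hb rfl hlt
              have h6 := hT.right e he hb
              simp only at this
              linarith
        · simp at hb
      · simp only
        rw [abs_of_nonneg, abs_of_nonneg, abs_of_nonneg, abs_of_nonneg] <;> linarith
  | true =>
    obtain ⟨h1, h2⟩ := hr rfl
    have hx := h.right _ hq rfl
    simp only at h1 h2 hx
    cases b' with
    | false =>
      have h3 := h.left _ hq' rfl
      simp only at h3
      exact same (le_antisymm (h.mono _ hq _ hq' rfl rfl (h1.trans_lt h3)) h2)
    | true =>
      have h3 := h.right _ hq' rfl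
      simp only at h3
      refine ⟨⟨?_, ?_, ?_, hord⟩, ?_⟩
      · intro e he hb
        rcases hm e he with he | rfl
        · exact hT.left e he hb
        · simp at hb
      · intro e he hb
        rcases hm e he with he | rfl
        · exact hT.right e he hb
        · exact h3.trans h2
      · intro e he e' he' hb hb' hlt
        rcases hm e' he' with he' | rfl
        · rcases hm e he with he | rfl
          · exact hT.mono e he e' he' hb hb' hlt
          · rcases lt_or_ge x e'.1.1 with h5 | h5
            · exact h.mono ((x, true), t) hq e' (hin e' he') rfl hb' h5
            · have := hT.mono _ hmem e' he' rfl hb' hlt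
              have h6 := hT.left e' he' hb'
              simp only at this
              linarith
        · simp at hb'
      · simp only
        rw [abs_of_nonpos, abs_of_nonpos, abs_of_nonpos, abs_of_nonpos] <;> linarith

/-- With such advice, LR uses all the partners, and has the cost of the given matching. -/
theorem lrRun_perm_and_cost {s : List ℝ} (hs : s.Pairwise (· ≤ ·)) (F : Finset ℕ)
    (l : List ((ℝ × Bool) × ℕ)) (hl : IsDirected s l) (hn : (l.map Prod.snd).Nodup)
    (hF : (l.map Prod.snd).toFinset = F) (hlt : ∀ j ∈ F, j < s.length) :
    (lrRun s F (l.map Prod.fst)).Perm (l.map Prod.snd) ∧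
      (List.zipWith (fun q j => |q.1 - s.getD j 0|) (l.map Prod.fst)
        (lrRun s F (l.map Prod.fst))).sum = (l.map fun e => |e.1.1 - s.getD e.2 0|).sum := by
  -- The induction is on the length because the list passed on may be the tail with one partner
  -- exchanged, rather than the tail itself.
  induction hlen : l.length generalizing l F with
  | zero =>
    obtain rfl : l = [] := List.length_eq_zero_iff.1 hlen
    simp [lrRun]
  | succ m ih =>
    rcases l with _ | ⟨⟨q, t⟩, l⟩
    · simp at hlen
    have htF : t ∈ F := by rw [← hF]; simp
    set u := (lrServe s F q.1).eval (fun _ => q.2) with hu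
    have hL : q.2 = false → u ∈ F ∧ s.getD t 0 ≤ s.getD u 0 ∧ s.getD u 0 ≤ q.1 := by
      intro hb
      have := lrServe_left hs hlt htF (hl.left (q, t) (by simp) hb)
      rw [hu, hb]
      exact this
    have hR : q.2 = true → u ∈ F ∧ q.1 ≤ s.getD u 0 ∧ s.getD u 0 ≤ s.getD t 0 := by
      intro hb
      have := lrServe_right hs hlt htF (hl.right (q, t) (by simp) hb)
      rw [hu, hb]
      exact this
    have huF : u ∈ F := by
      cases hb : q.2 with
      | false => exact (hL hb).1
      | true => exact (hR hb).1
    have hrun : lrRun s F (((q, t) :: l).map Prod.fst) =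
        u :: lrRun s (F.erase u) (l.map Prod.fst) := rfl
    rw [hrun]
    simp only [List.map_cons, List.nodup_cons] at hn hF ⊢
    have hlt' : ∀ j ∈ F.erase u, j < s.length := fun j hj => hlt j (Finset.mem_of_mem_erase hj)
    by_cases hut : u = t
    · obtain ⟨h1, h2⟩ := ih (F.erase u) l hl.tail hn.2 (by
        rw [← hF, hut, List.toFinset_cons, Finset.erase_insert (by simpa using hn.1)]) hlt'
        (by simpa using hlen)
      refine ⟨by rw [hut] at h1 ⊢; exact h1.cons t, ?_⟩
      rw [List.zipWith_cons_cons, List.sum_cons, List.sum_cons, h2, hut]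
    -- Since `F` consists of the partners in the list, `u` belongs to a later request, which
    -- inherits `t`.
    · have hul : u ∈ l.map Prod.snd := by
        rw [← hF] at huF
        simpa [hut] using huF
      obtain ⟨⟨q', u'⟩, hq', hu'⟩ := List.mem_map.1 hul
      obtain rfl : u' = u := hu'
      obtain ⟨l₁, l₂, rfl⟩ := List.append_of_mem hq'
      obtain ⟨hd, hc⟩ := hl.swap (fun hb => (hL hb).2) (fun hb => (hR hb).2)
      simp only [List.map_append, List.map_cons] at hn hF hut
      have hperm : (t :: (l₁.map Prod.snd ++ u :: l₂.map Prod.snd)).Perm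
          (u :: (l₁.map Prod.snd ++ t :: l₂.map Prod.snd)) := by
        calc _ = (t :: l₁.map Prod.snd) ++ u :: l₂.map Prod.snd := rfl
          _ |>.Perm (u :: ((t :: l₁.map Prod.snd) ++ l₂.map Prod.snd)) := List.perm_middle
          _ |>.Perm _ := (List.perm_middle.symm).cons u
      have hnd : (u :: (l₁.map Prod.snd ++ t :: l₂.map Prod.snd)).Nodup :=
        hperm.nodup_iff.1 (List.nodup_cons.2 hn)
      obtain ⟨h1, h2⟩ := ih (F.erase u) (l₁ ++ (q', t) :: l₂) hd
        (by simpa using (List.nodup_cons.1 hnd).2)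
        (by
          have h3 : (u :: (l₁.map Prod.snd ++ t :: l₂.map Prod.snd)).toFinset = F := by
            rw [← hF]; exact (List.toFinset_eq_of_perm _ _ hperm).symm
          rw [← h3, List.toFinset_cons, Finset.erase_insert]
          · simp
          · exact fun h => (List.nodup_cons.1 hnd).1 (List.mem_toFinset.1 h)) hlt'
        (by simpa using hlen)
      have hmap : (l₁ ++ (q', u) :: l₂).map Prod.fst = (l₁ ++ (q', t) :: l₂).map Prod.fst := by
        simp
      rw [hmap]
      constructor
      · refine (h1.cons u).trans ?_
        simp only [List.map_append, List.map_cons]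
        exact hperm.symm
      · rw [List.zipWith_cons_cons, List.sum_cons, List.sum_cons, h2]
        simp only [List.map_append, List.map_cons, List.sum_append, List.sum_cons]
        linarith

/-! ### Blocks -/

theorem blockEnd_zero (n k : ℕ) : blockEnd n k 0 = 0 := by simp [blockEnd]

theorem blockEnd_self {n k : ℕ} (hk : 0 < k) : blockEnd n k k = n := by
  have := Nat.div_add_mod n k
  have := Nat.mod_lt n hk
  simp only [blockEnd]
  rw [min_eq_right (by omega)]
  assumption

theorem blockEnd_mono (n k : ℕ) : Monotone (blockEnd n k) := by
  intro i j hij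
  simp only [blockEnd]
  have := Nat.mul_le_mul_right (n / k) hij
  omega

theorem blockEnd_lt {n k i j : ℕ} (hk : 0 < k) (hkn : k ≤ n) (hij : i < j) :
    blockEnd n k i < blockEnd n k j := by
  have h1 : 0 < n / k := Nat.div_pos hkn hk
  have := Nat.mul_lt_mul_of_pos_right hij h1
  simp only [blockEnd]
  omega

/-- A block has `n / k` servers, and one more only if `k` does not divide `n`, in which case the
ceiling exceeds `n / k` as well. -/
theorem blockEnd_sub_le {n k j : ℕ} (hk : 0 < k) (hj : 1 ≤ j) :
    blockEnd n k j - blockEnd n k (j - 1) ≤ ⌈(n : ℝ) / k⌉₊ := by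
  obtain ⟨i, rfl⟩ : ∃ i, j = i + 1 := ⟨j - 1, by omega⟩
  rw [Nat.add_sub_cancel]
  have hk' : (0 : ℝ) < k := by exact_mod_cast hk
  have hdm := Nat.div_add_mod n k
  have h1 : n / k ≤ ⌈(n : ℝ) / k⌉₊ := by
    have h := Nat.le_ceil ((n : ℝ) / k)
    rw [div_le_iff₀ hk'] at h
    have h' : n ≤ ⌈(n : ℝ) / k⌉₊ * k := by exact_mod_cast h
    exact Nat.div_le_of_le_mul (by rwa [mul_comm] at h')
  have h2 : n % k ≠ 0 → n / k + 1 ≤ ⌈(n : ℝ) / k⌉₊ := by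
    intro h0
    rw [Nat.succ_le_iff, Nat.lt_ceil, lt_div_iff₀ hk']
    have : n / k * k < n := by rw [mul_comm]; omega
    exact_mod_cast this
  have h3 : (i + 1) * (n / k) = i * (n / k) + n / k := by ring
  simp only [blockEnd, h3]
  by_cases h0 : n % k = 0
  · simp only [h0]; omega
  · have := h2 h0
    omega

/-- The servers lie between `1` and `N - 1`, and there are at least `k` of them. -/
structure IsLine (s : List ℝ) (k : ℕ) : Prop where
  sorted : s.Pairwise (· ≤ ·)
  pos : 0 < k
  le_length : k ≤ s.length
  one_le : ∀ i < s.length, 1 ≤ s.getD i 0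
  le_span : ∀ i < s.length, s.getD i 0 ≤ span s - 1

namespace IsLine

variable {s : List ℝ} {k : ℕ}

theorem blockEnd_pos (h : IsLine s k) {i : ℕ} (hi : 0 < i) : 0 < blockEnd s.length k i := by
  simpa [blockEnd_zero] using blockEnd_lt h.pos h.le_length hi

theorem blockEnd_lt_length (h : IsLine s k) {i : ℕ} (hi : i < k) :
    blockEnd s.length k i < s.length := by
  simpa [blockEnd_self h.pos] using blockEnd_lt h.pos h.le_length hi

theorem le_border (h : IsLine s k) {i t : ℕ} (hi : i < k) (ht : t < blockEnd s.length k i) :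
    s.getD t 0 ≤ border s k i := by
  have hlt := h.blockEnd_lt_length hi
  have h1 := getD_le_getD h.sorted (i := t) (j := blockEnd s.length k i - 1) (by omega) (by omega)
  have h2 := getD_le_getD h.sorted (i := t) (j := blockEnd s.length k i) (by omega) hlt
  unfold border
  linarith

theorem border_le (h : IsLine s k) {i t : ℕ} (ht : blockEnd s.length k i ≤ t)
    (hts : t < s.length) : border s k i ≤ s.getD t 0 := by
  have h1 := getD_le_getD h.sorted (i := blockEnd s.length k i - 1) (j := t) (by omega) (by omega)
  have h2 := getD_le_getD h.sorted ht hts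
  unfold border
  linarith

theorem border_mono (h : IsLine s k) {i j : ℕ} (hij : i ≤ j) (hj : j < k) :
    border s k i ≤ border s k j := by
  rcases hij.eq_or_lt with rfl | hlt
  · exact le_rfl
  · exact (h.border_le le_rfl (h.blockEnd_lt_length (hlt.trans hj))).trans
      (h.le_border hj (blockEnd_lt h.pos h.le_length hlt))

theorem one_le_border (h : IsLine s k) {i : ℕ} (hi : 0 < i) (hik : i < k) :
    1 ≤ border s k i :=
  (h.one_le 0 (h.pos.trans_le h.le_length)).trans (h.le_border hik (h.blockEnd_pos hi))

theorem border_le_span (h : IsLine s k) {i : ℕ} (hik : i < k) :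
    border s k i ≤ span s - 1 :=
  (h.border_le le_rfl (h.blockEnd_lt_length hik)).trans (h.le_span _ (h.blockEnd_lt_length hik))

theorem blockOf_spec (hk : 0 < k) (x : ℝ) : 1 ≤ blockOf s k x ∧ blockOf s k x ≤ k ∧
    (1 < blockOf s k x → border s k (blockOf s k x - 1) < x) ∧
    (blockOf s k x < k → x ≤ border s k (blockOf s k x)) := by
  unfold blockOf
  cases hf : (List.range' 1 (k - 1)).find? (fun i => decide (x ≤ border s k i)) with
  | none =>
    rw [List.find?_range'_eq_none] at hf
    simp only [Option.getD_none]
    refine ⟨hk, le_rfl, fun h => ?_, fun h => absurd h (lt_irrefl _)⟩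
    have := hf (k - 1) (by omega) (by omega)
    simpa using this
  | some i =>
    rw [List.find?_range'_eq_some] at hf
    obtain ⟨h1, h2, h3⟩ := hf
    rw [List.mem_range'_1] at h2
    simp only [Option.getD_some]
    refine ⟨h2.1, by omega, fun h => ?_, fun _ => by simpa using h1⟩
    have := h3 (i - 1) (by omega) (by omega)
    simpa using this

/-- The block of a point depends only on which borders lie at or beyond it. Monotonicity and
invariance under truncation are both instances of this. -/
theorem blockOf_le_of (h : IsLine s k) {x x' : ℝ}
    (hx : ∀ i, 0 < i → i < k → x' ≤ border s k i → x ≤ border s k i) :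
    blockOf s k x ≤ blockOf s k x' := by
  obtain ⟨h1, h2, h3, -⟩ := blockOf_spec (s := s) h.pos x
  obtain ⟨h1', h2', -, h4'⟩ := blockOf_spec (s := s) h.pos x'
  by_contra! hlt
  have h5 := h3 (by omega)
  have h6 := hx _ h1' (by omega) (h4' (by omega))
  have h7 := h.border_mono (i := blockOf s k x') (j := blockOf s k x - 1) (by omega) (by omega)
  linarith

theorem blockOf_mono (h : IsLine s k) : Monotone (blockOf s k) := fun _ _ hx =>
  h.blockOf_le_of fun _ _ _ h' => hx.trans h'

/-- All borders lie in `[1, N - 1]`, so truncation to `[0, N]` carries no point across a border. -/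
theorem blockOf_trunc (h : IsLine s k) (x : ℝ) : blockOf s k (trunc s x) = blockOf s k x := by
  apply le_antisymm <;> refine h.blockOf_le_of fun i hi hik hx => ?_
  · have := h.one_le_border hi hik
    exact max_le (by linarith) ((min_le_right _ _).trans hx)
  · have h1 := h.border_le_span hik
    rcases min_le_iff.1 ((le_max_right _ _).trans hx) with h2 | h2
    · linarith
    · exact h2

end IsLine

/-! ### The marking procedures -/

/-- The marking procedures know only how many servers to mark, so an interval has to be recovered
from one end and its cardinality. -/
theorem eq_Ico_of_convex {D : Finset ℕ} (hD : D.Nonempty)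
    (hc : ∀ a ∈ D, ∀ b ∈ D, ∀ t, a ≤ t → t ≤ b → t ∈ D) :
    D = Finset.Ico (D.min' hD) (D.max' hD + 1) ∧ D.card = D.max' hD + 1 - D.min' hD := by
  have : D = Finset.Ico (D.min' hD) (D.max' hD + 1) := by
    ext t
    simp only [Finset.mem_Ico, Nat.lt_succ_iff]
    exact ⟨fun h => ⟨D.min'_le t h, D.le_max' t h⟩,
      fun h => hc _ (D.min'_mem hD) _ (D.max'_mem hD) t h.1 h.2⟩
  exact ⟨this, by conv_lhs => rw [this, Nat.card_Ico]⟩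

/-- Here `e` stands for `blockEnd` and `β t` for the block of the request paired with server `t`.
Since `β` is monotone, the servers to be marked in round `q + 1` form an interval `D`. It starts at
the first unmarked index from `e (q + 1)` on: an index `t` between `e (q + 1)` and `D` has `β t ≤
q`, hence `e (β t) ≤ t`, and was marked before. -/
theorem foldl_markRight {n k : ℕ} {e β m : ℕ → ℕ} (he : Monotone e)
    (hβ : ∀ t t', t ≤ t' → t' < n → β t ≤ β t')
    (hm : ∀ i, 0 < i → i < k → m i = ((Finset.range n).filter fun t => β t = i ∧ e i ≤ t).card)
    (hβ1 : ∀ t < n, 1 ≤ β t) (q : ℕ) (hq : q < k) :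
    (List.range' 1 q).foldl (fun M i =>
      let j := least (Finset.Ico (e i) n \ M)
      M ∪ Finset.Ico j (j + m i)) ∅ =
    (Finset.range n).filter fun t => e (β t) ≤ t ∧ β t ≤ q := by
  induction q with
  | zero =>
    ext t
    simp only [List.range'_zero, List.foldl_nil, Finset.notMem_empty, Finset.mem_filter,
      Finset.mem_range, false_iff]
    rintro ⟨h1, -, h2⟩
    have := hβ1 t h1
    omega
  | succ q ih =>
    rw [List.range'_1_concat, List.foldl_append, ih (by omega)]
    simp only [List.foldl_cons, List.foldl_nil, add_comm 1 q]
    set M := (Finset.range n).filter fun t => e (β t) ≤ t ∧ β t ≤ q with hM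
    set D := (Finset.range n).filter fun t => β t = q + 1 ∧ e (q + 1) ≤ t with hD
    have hu : (Finset.range n).filter (fun t => e (β t) ≤ t ∧ β t ≤ q + 1) = M ∪ D := by
      ext t
      simp only [hM, hD, Finset.mem_union, Finset.mem_filter, Finset.mem_range]
      constructor
      · rintro ⟨h1, h2, h3⟩
        rcases Nat.lt_or_ge q (β t) with h4 | h4
        · have h5 : β t = q + 1 := by omega
          exact Or.inr ⟨h1, h5, h5 ▸ h2⟩
        · exact Or.inl ⟨h1, h2, h4⟩
      · rintro (⟨h1, h2, h3⟩ | ⟨h1, h2, h3⟩)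
        · exact ⟨h1, h2, by omega⟩
        · exact ⟨h1, by rwa [h2], by omega⟩
    rw [hu, hm (q + 1) (by omega) hq, ← hD]
    -- For empty `D` the interval to be marked has length `0`, so the value of `least` is
    -- irrelevant, even if it is junk.
    rcases D.eq_empty_or_nonempty with h0 | h0
    · simp [h0]
    · have hmem : ∀ t, t ∈ D ↔ t < n ∧ β t = q + 1 ∧ e (q + 1) ≤ t := fun t => by simp [hD]
      obtain ⟨h1, h2⟩ := eq_Ico_of_convex h0 (fun a ha b hb t hat htb => by
        rw [hmem] at ha hb ⊢
        have := hβ a t hat (by omega)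
        have := hβ t b htb hb.1
        omega)
      have ha := (hmem _).1 (D.min'_mem h0)
      have hj : least (Finset.Ico (e (q + 1)) n \ M) = D.min' h0 := by
        apply least_eq
        · simp only [hM, Finset.mem_sdiff, Finset.mem_Ico, Finset.mem_filter, Finset.mem_range]
          omega
        · intro t ht
          simp only [hM, Finset.mem_sdiff, Finset.mem_Ico, Finset.mem_filter,
            Finset.mem_range] at ht
          by_contra! hlt
          have h3 := hβ t _ hlt.le ha.1
          rcases Nat.lt_or_ge q (β t) with h4 | h4
          · have := D.min'_le t ((hmem t).2 ⟨ht.1.2, by omega, ht.1.1⟩)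
            omega
          · exact ht.2 ⟨ht.1.2, (he (by omega)).trans ht.1.1, h4⟩
      have hle := D.min'_le _ (D.max'_mem h0)
      rw [hj, h2, show D.min' h0 + (D.max' h0 + 1 - D.min' h0) = D.max' h0 + 1 by omega, ← h1]

/-- Mirror image of `foldl_markRight`. Blocks are handled from `k` downwards, so after `q` rounds
those numbered `k + 1 - q` or more are done. An index below `e (i - 1)` but beyond the new interval
belongs to a higher block and was marked before. -/
theorem foldl_markLeft {n k : ℕ} {e β m : ℕ → ℕ} (he : Monotone e) (hek : e k ≤ n)
    (hβ : ∀ t t', t ≤ t' → t' < n → β t ≤ β t')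
    (hm : ∀ i, 1 < i → i ≤ k →
      m i = ((Finset.range n).filter fun t => β t = i ∧ t < e (i - 1)).card)
    (hβk : ∀ t < n, β t ≤ k) (q : ℕ) (hq : q < k) :
    (List.range' (k + 1 - q) q).reverse.foldl (fun M i =>
      let j := greatest (Finset.range (e (i - 1)) \ M)
      M ∪ Finset.Ico (j + 1 - m i) (j + 1)) ∅ =
    (Finset.range n).filter fun t => t < e (β t - 1) ∧ k + 1 - q ≤ β t := by
  induction q with
  | zero =>
    ext t
    simp only [List.range'_zero, List.reverse_nil, List.foldl_nil, Finset.notMem_empty,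
      Finset.mem_filter, Finset.mem_range, false_iff]
    rintro ⟨h1, -, h2⟩
    have := hβk t h1
    omega
  | succ q ih =>
    obtain ⟨i, hi⟩ : ∃ i, k + 1 - (q + 1) = i := ⟨_, rfl⟩
    have hi' : k + 1 - q = i + 1 := by omega
    rw [hi, List.range'_succ, List.reverse_cons, List.foldl_append, ← hi', ih (by omega), hi']
    simp only [List.foldl_cons, List.foldl_nil]
    set M := (Finset.range n).filter fun t => t < e (β t - 1) ∧ i + 1 ≤ β t with hM
    set D := (Finset.range n).filter fun t => β t = i ∧ t < e (i - 1) with hD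
    have hu : (Finset.range n).filter (fun t => t < e (β t - 1) ∧ i ≤ β t) = M ∪ D := by
      ext t
      simp only [hM, hD, Finset.mem_union, Finset.mem_filter, Finset.mem_range]
      constructor
      · rintro ⟨h1, h2, h3⟩
        rcases Nat.lt_or_ge i (β t) with h4 | h4
        · exact Or.inl ⟨h1, h2, h4⟩
        · have h5 : β t = i := by omega
          exact Or.inr ⟨h1, h5, h5 ▸ h2⟩
      · rintro (⟨h1, h2, h3⟩ | ⟨h1, h2, h3⟩)
        · exact ⟨h1, h2, by omega⟩
        · exact ⟨h1, by rwa [h2], by omega⟩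
    rw [hu, hm i (by omega) (by omega), ← hD]
    rcases D.eq_empty_or_nonempty with h0 | h0
    · simp [h0]
    · have hmem : ∀ t, t ∈ D ↔ t < n ∧ β t = i ∧ t < e (i - 1) := fun t => by simp [hD]
      obtain ⟨h1, h2⟩ := eq_Ico_of_convex h0 (fun a ha b hb t hat htb => by
        rw [hmem] at ha hb ⊢
        have := hβ a t hat (by omega)
        have := hβ t b htb hb.1
        omega)
      have hb := (hmem _).1 (D.max'_mem h0)
      have hj : greatest (Finset.range (e (i - 1)) \ M) = D.max' h0 := by
        apply greatest_eq
        · simp only [hM, Finset.mem_sdiff, Finset.mem_filter, Finset.mem_range]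
          omega
        · intro t ht
          simp only [hM, Finset.mem_sdiff, Finset.mem_filter, Finset.mem_range] at ht
          by_contra! hlt
          have htn : t < n := ht.1.trans_le ((he (by omega)).trans hek)
          have h3 := hβ _ t hlt.le htn
          rcases Nat.lt_or_ge i (β t) with h4 | h4
          · exact ht.2 ⟨htn, ht.1.trans_le (he (by omega)), h4⟩
          · have := D.le_max' t ((hmem t).2 ⟨htn, by omega, ht.1⟩)
            omega
      have hle := D.min'_le _ (D.max'_mem h0)
      rw [hj, h2, show D.max' h0 + 1 - (D.max' h0 + 1 - D.min' h0) = D.min' h0 by omega, ← h1]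

/-! ### The sorted matching and its labels -/

/-- The block of the `t`-th request of the sorted list `ys`. -/
def pairBlock (s : List ℝ) (k : ℕ) (ys : List ℝ) (t : ℕ) : ℕ := blockOf s k (ys.getD t 0)

/-- The label of the `t`-th request of the sorted list `ys`, whose pair is the `t`-th server. -/
def pairLabel (s : List ℝ) (k : ℕ) (ys : List ℝ) (t : ℕ) : Label :=
  if t < blockEnd s.length k (pairBlock s k ys t - 1) then Label.left
  else if blockEnd s.length k (pairBlock s k ys t) ≤ t then Label.right
  else Label.inside

/-- The positions and labels of the sorted requests. -/
def pairList (s : List ℝ) (k : ℕ) (ys : List ℝ) : List (ℝ × Label) :=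
  (List.range s.length).map fun t => (ys.getD t 0, pairLabel s k ys t)

/-- `ys` is the sorted list of the positions of the requests, which are natural numbers. -/
structure IsPositions (s : List ℝ) (ys : List ℝ) : Prop where
  sorted : ys.Pairwise (· ≤ ·)
  length : ys.length = s.length
  nat : ∀ t < s.length, ∃ m : ℕ, m ≤ span s ∧ ys.getD t 0 = m

section

variable {s ys : List ℝ} {k : ℕ}

theorem pairLabel_eq_left {t : ℕ} : pairLabel s k ys t = Label.left ↔
    t < blockEnd s.length k (pairBlock s k ys t - 1) := by
  unfold pairLabel
  split_ifs <;> simp_all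

theorem pairLabel_eq_right {t : ℕ} : pairLabel s k ys t = Label.right ↔
    blockEnd s.length k (pairBlock s k ys t) ≤ t := by
  have := blockEnd_mono s.length k (Nat.sub_le (pairBlock s k ys t) 1)
  unfold pairLabel
  split_ifs <;> simp_all
  omega

theorem pairLabel_eq_inside {t : ℕ} : pairLabel s k ys t = Label.inside ↔
    blockEnd s.length k (pairBlock s k ys t - 1) ≤ t ∧
      t < blockEnd s.length k (pairBlock s k ys t) := by
  unfold pairLabel
  split_ifs <;> simp_all

theorem IsPositions.getD_mono (h : IsPositions s ys) {t t' : ℕ} (htt : t ≤ t')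
    (ht : t' < s.length) : ys.getD t 0 ≤ ys.getD t' 0 :=
  getD_le_getD h.sorted htt (by rw [h.length]; exact ht)

theorem IsPositions.pairBlock_mono (h : IsPositions s ys) (hs : IsLine s k) {t t' : ℕ}
    (htt : t ≤ t') (ht : t' < s.length) : pairBlock s k ys t ≤ pairBlock s k ys t' :=
  hs.blockOf_mono (h.getD_mono htt ht)

theorem pairBlock_mem (hs : IsLine s k) (t : ℕ) :
    1 ≤ pairBlock s k ys t ∧ pairBlock s k ys t ≤ k :=
  ⟨(IsLine.blockOf_spec hs.pos _).1, (IsLine.blockOf_spec hs.pos _).2.1⟩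

theorem one_lt_pairBlock_of_left {t : ℕ}
    (h : pairLabel s k ys t = Label.left) : 1 < pairBlock s k ys t := by
  rw [pairLabel_eq_left] at h
  by_contra! h1
  rw [Nat.sub_eq_zero_of_le h1, blockEnd_zero] at h
  omega

theorem pairBlock_lt_of_right (hs : IsLine s k) {t : ℕ} (ht : t < s.length)
    (h : pairLabel s k ys t = Label.right) : pairBlock s k ys t < k := by
  rw [pairLabel_eq_right] at h
  by_contra! h1
  rw [le_antisymm (pairBlock_mem hs t).2 h1, blockEnd_self hs.pos] at h
  omega

/-- The advice `a` describes the sorted matching. -/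
structure Describes (s : List ℝ) (k : ℕ) (ys : List ℝ) (a : DivideAdvice) : Prop where
  qL_none : ∀ j, 1 < j → j ≤ k →
    (∀ t < s.length, pairBlock s k ys t = j → pairLabel s k ys t ≠ Label.left) → a.qL j = 0
  qL_some : ∀ t < s.length, pairLabel s k ys t = Label.left →
    ∃ t' < s.length, pairBlock s k ys t' = pairBlock s k ys t ∧ pairLabel s k ys t' = Label.left ∧
      ys.getD t 0 ≤ ys.getD t' 0 ∧ ys.getD t' 0 = a.qL (pairBlock s k ys t)
  dL : ∀ t < s.length, pairLabel s k ys t = Label.left →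
    ys.getD t 0 = a.qL (pairBlock s k ys t) → a.dL (pairBlock s k ys t) =
      (pairList s k ys).count (ys.getD t 0, Label.inside) +
        (pairList s k ys).count (ys.getD t 0, Label.right)
  qR_none : ∀ j, 0 < j → j < k →
    (∀ t < s.length, pairBlock s k ys t = j → pairLabel s k ys t ≠ Label.right) →
      span s ≤ a.qR j
  qR_some : ∀ t < s.length, pairLabel s k ys t = Label.right →
    ∃ t' < s.length, pairBlock s k ys t' = pairBlock s k ys t ∧ pairLabel s k ys t' = Label.right ∧
      ys.getD t' 0 ≤ ys.getD t 0 ∧ ys.getD t' 0 = a.qR (pairBlock s k ys t)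
  dR : ∀ t < s.length, pairLabel s k ys t = Label.right →
    ys.getD t 0 = a.qR (pairBlock s k ys t) → a.dR (pairBlock s k ys t) =
      (pairList s k ys).count (ys.getD t 0, Label.inside)
  mL : ∀ j, 1 < j → j ≤ k → a.mL j = ((Finset.range s.length).filter fun t =>
    pairBlock s k ys t = j ∧ t < blockEnd s.length k (j - 1)).card
  mR : ∀ j, 0 < j → j < k → a.mR j = ((Finset.range s.length).filter fun t =>
    pairBlock s k ys t = j ∧ blockEnd s.length k j ≤ t).card

/-- The two procedures cover right labels in blocks before the last and left labels in blocks after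
the first. Nothing is missed, because the last block has no right label and the first no left label.
-/
theorem mem_marked_iff (hs : IsLine s k) (hy : IsPositions s ys) {a : DivideAdvice}
    (ha : Describes s k ys a) (t : ℕ) :
    t ∈ marked s k a ↔ t < s.length ∧ pairLabel s k ys t ≠ Label.inside := by
  have hR : markRight s k a = (Finset.range s.length).filter fun t =>
      blockEnd s.length k (pairBlock s k ys t) ≤ t ∧ pairBlock s k ys t ≤ k - 1 :=
    foldl_markRight (k := k) (blockEnd_mono _ _) (fun t t' h h' => hy.pairBlock_mono hs h h')
      ha.mR (fun t _ => (pairBlock_mem hs t).1) (k - 1) (by have := hs.pos; omega)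
  have hL : markLeft s k a = (Finset.range s.length).filter fun t =>
      t < blockEnd s.length k (pairBlock s k ys t - 1) ∧ k + 1 - (k - 1) ≤ pairBlock s k ys t := by
    have h2 : k + 1 - (k - 1) = 2 := by have := hs.pos; omega
    have := foldl_markLeft (n := s.length) (k := k) (m := a.mL) (blockEnd_mono s.length k)
      (blockEnd_self hs.pos).le
      (fun t t' h h' => hy.pairBlock_mono hs h h') ha.mL (fun t _ => (pairBlock_mem hs t).2) (k - 1)
      (by have := hs.pos; omega)
    rw [h2] at this ⊢
    exact this
  have h1 : pairLabel s k ys t ≠ Label.inside ↔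
      pairLabel s k ys t = Label.left ∨ pairLabel s k ys t = Label.right := by
    cases pairLabel s k ys t <;> simp
  rw [marked, hR, hL, Finset.mem_union, Finset.mem_filter, Finset.mem_filter, Finset.mem_range, h1]
  constructor
  · rintro (⟨h1, h2, -⟩ | ⟨h1, h2, -⟩)
    · exact ⟨h1, Or.inr (pairLabel_eq_right.2 h2)⟩
    · exact ⟨h1, Or.inl (pairLabel_eq_left.2 h2)⟩
  · rintro ⟨h1, h2 | h2⟩
    · have := one_lt_pairBlock_of_left h2
      exact Or.inr ⟨h1, pairLabel_eq_left.1 h2, by omega⟩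
    · have := pairBlock_lt_of_right hs h1 h2
      exact Or.inl ⟨h1, pairLabel_eq_right.1 h2, by omega⟩

/-! ### The labels given by DIVIDE -/

/-- The truncated position and the label of a served request. -/
def Served.proj (s : List ℝ) (e : Served) : ℝ × Label := (trunc s e.pos, e.label)

theorem count_inside_proj (s : List ℝ) (log : List Served) (y : ℝ) :
    ((log.filter fun e => decide (trunc s e.pos = y)).filter
      fun e => e.label = Label.inside).length =
      (log.map (Served.proj s)).count (y, Label.inside) := by
  induction log with
  | nil => simp
  | cons e l ih =>
    by_cases h1 : trunc s e.pos = y <;> by_cases h2 : e.label = Label.inside <;>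
    simp [h1, h2, Served.proj] at ih ⊢ <;> exact ih

theorem count_ne_left_proj (s : List ℝ) (log : List Served) (y : ℝ) :
    ((log.filter fun e => decide (trunc s e.pos = y)).filter
      fun e => e.label ≠ Label.left).length =
      (log.map (Served.proj s)).count (y, Label.inside) +
        (log.map (Served.proj s)).count (y, Label.right) := by
  induction log with
  | nil => simp
  | cons e l ih =>
    by_cases h1 : trunc s e.pos = y <;> cases h2 : e.label <;>
    simp [h1, h2, Served.proj] at ih ⊢ <;> omega

theorem count_map_fst (l : List (ℝ × Label)) (y : ℝ) : (l.map Prod.fst).count y =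
    l.count (y, Label.left) + l.count (y, Label.inside) + l.count (y, Label.right) := by
  induction l with
  | nil => simp
  | cons e l ih =>
    obtain ⟨x, b⟩ := e
    by_cases h1 : x = y <;> cases b <;> simp [h1] at ih ⊢ <;> omega

theorem mem_pairList {p : ℝ × Label} : p ∈ pairList s k ys ↔
    ∃ t < s.length, ys.getD t 0 = p.1 ∧ pairLabel s k ys t = p.2 := by
  simp only [pairList, List.mem_map, List.mem_range]
  constructor
  · rintro ⟨t, h, rfl⟩; exact ⟨t, h, rfl, rfl⟩
  · rintro ⟨t, h, h1, h2⟩; exact ⟨t, h, by rw [h1, h2]⟩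

theorem IsPositions.map_fst_pairList (hy : IsPositions s ys) :
    (pairList s k ys).map Prod.fst = ys := by
  simp only [pairList, List.map_map]
  apply List.ext_getElem
  · simp [hy.length]
  · intro i h1 h2
    simp [h2]

/-- The labels given by DIVIDE, in terms of the numbers of labels of the sorted matching. -/
theorem labelOf_eq (hs : IsLine s k) (hy : IsPositions s ys) {a : DivideAdvice}
    (ha : Describes s k ys a) (log : List Served) (x : ℝ) {P : List (ℝ × Label)}
    (hP : P = log.map (Served.proj s)) {y : ℝ} (hxy : trunc s x = y)
    (hlt : (P.map Prod.fst).count y < ((pairList s k ys).map Prod.fst).count y) :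
    labelOf s k a log x =
      if (pairList s k ys).count (y, Label.inside) + (pairList s k ys).count (y, Label.right) ≤
        P.count (y, Label.inside) + P.count (y, Label.right) then Label.left
      else if (pairList s k ys).count (y, Label.inside) ≤ P.count (y, Label.inside)
        then Label.right
      else Label.inside := by
  set G := pairList s k ys with hG
  obtain ⟨t₀, ht₀, hyt₀⟩ : ∃ t < s.length, ys.getD t 0 = y := by
    have : 0 < (G.map Prod.fst).count y := by omega
    rw [List.count_pos_iff, List.mem_map] at this
    obtain ⟨p, hp, rfl⟩ := this
    obtain ⟨t, h1, h2, -⟩ := mem_pairList.1 hp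
    exact ⟨t, h1, h2⟩
  have hj : blockOf s k x = pairBlock s k ys t₀ := by
    rw [pairBlock, hyt₀, ← hxy, hs.blockOf_trunc]
  have hblock : ∀ t, ys.getD t 0 = y → pairBlock s k ys t = pairBlock s k ys t₀ := by
    intro t h; rw [pairBlock, pairBlock, h, hyt₀]
  rw [count_map_fst, count_map_fst] at hlt
  have hcount0 : ∀ b, (∀ t < s.length, ys.getD t 0 = y → pairLabel s k ys t ≠ b) →
      G.count (y, b) = 0 := by
    intro b h
    rw [List.count_eq_zero, hG, mem_pairList]
    rintro ⟨t, h1, h2, h3⟩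
    exact h t h1 h2 h3
  obtain ⟨hj1, hjk⟩ := pairBlock_mem (ys := ys) hs t₀
  obtain ⟨-, -, hbl, hbr⟩ := IsLine.blockOf_spec (s := s) hs.pos (ys.getD t₀ 0)
  set j := pairBlock s k ys t₀ with hjdef
  -- Below `qL` every request at `y` is labelled left; at `qL` the two conditions compare the same
  -- number `dL`; above `qL` none is labelled left, so by `hlt` some other label at `y` is still to
  -- be given. If the block has no left label, `qL` is `0`, which lies before every request of a
  -- block after the first.
  have hleft : (1 < j ∧ (y < a.qL j ∨ (y = a.qL j ∧
      a.dL j ≤ P.count (y, Label.inside) + P.count (y, Label.right)))) ↔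
      G.count (y, Label.inside) + G.count (y, Label.right) ≤
        P.count (y, Label.inside) + P.count (y, Label.right) := by
    by_cases hex : ∃ t < s.length, pairBlock s k ys t = j ∧ pairLabel s k ys t = Label.left
    · obtain ⟨t, h1, h2, h3⟩ := hex
      have h1j : 1 < j := h2 ▸ one_lt_pairBlock_of_left h3
      obtain ⟨t', h1', h2', h3', -, h5'⟩ := ha.qL_some t h1 h3
      rw [h2] at h2' h5'
      rcases lt_trichotomy y (a.qL j) with hlt' | heq | hgt
      · have hall : ∀ t < s.length, ys.getD t 0 = y → pairLabel s k ys t = Label.left := by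
          intro u hu huy
          rw [pairLabel_eq_left] at h3' ⊢
          rw [hblock u huy, ← h2']
          refine lt_trans ?_ h3'
          by_contra! hle
          have := hy.getD_mono hle hu
          linarith
        have h6 := hcount0 Label.inside fun u hu huy => by rw [hall u hu huy]; simp
        have h7 := hcount0 Label.right fun u hu huy => by rw [hall u hu huy]; simp
        simp [h1j, hlt', h6, h7]
      · have hd := ha.dL t' h1' h3' (by rw [h2', h5'])
        rw [h2', h5', ← heq] at hd
        simp [h1j, ← heq, hd, hG]
      · have h6 := hcount0 Label.left fun u hu huy hul => by
          obtain ⟨u', h1u, h2u, h3u, h4u, h5u⟩ := ha.qL_some u hu hul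
          rw [hblock u huy] at h5u
          linarith
        have : ¬ (y < a.qL j ∨ (y = a.qL j ∧
          a.dL j ≤ P.count (y, Label.inside) + P.count (y, Label.right))) := by
          rintro (h | ⟨h, -⟩) <;> linarith
        constructor
        · exact fun h => absurd h.2 this
        · omega
    · push Not at hex
      have h6 := hcount0 Label.left fun u hu huy hul => hex u hu (hblock u huy) hul
      constructor
      · rintro ⟨h1, h2⟩
        exfalso
        have h3 := hs.one_le_border (i := j - 1) (by omega) (by omega)
        have h4 := hbl h1
        rw [ha.qL_none j h1 hjk hex] at h2
        change border s k (j - 1) < _ at h4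
        rcases h2 with h2 | ⟨h2, -⟩ <;> simp at h2 <;> linarith
      · omega
  -- The assumption matters where nothing at `y` is labelled right: as the inside and right labels
  -- at `y` are not used up, an inside label is still to be given.
  have hright : ¬ (G.count (y, Label.inside) + G.count (y, Label.right) ≤
        P.count (y, Label.inside) + P.count (y, Label.right)) →
      ((j < k ∧ (a.qR j < y ∨ (y = a.qR j ∧ a.dR j ≤ P.count (y, Label.inside)))) ↔
      G.count (y, Label.inside) ≤ P.count (y, Label.inside)) := by
    intro hnl
    by_cases hex : ∃ t < s.length, pairBlock s k ys t = j ∧ pairLabel s k ys t = Label.right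
    · obtain ⟨t, h1, h2, h3⟩ := hex
      have h1j : j < k := h2 ▸ pairBlock_lt_of_right hs h1 h3
      obtain ⟨t', h1', h2', h3', -, h5'⟩ := ha.qR_some t h1 h3
      rw [h2] at h2' h5'
      rcases lt_trichotomy (a.qR j : ℝ) y with hlt' | heq | hgt
      · have hall : ∀ t < s.length, ys.getD t 0 = y → pairLabel s k ys t = Label.right := by
          intro u hu huy
          rw [pairLabel_eq_right] at h3' ⊢
          rw [hblock u huy, ← h2']
          refine h3'.trans ?_
          by_contra! hle
          have := hy.getD_mono hle.le h1'
          linarith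
        have h6 := hcount0 Label.inside fun u hu huy => by rw [hall u hu huy]; simp
        simp [h1j, hlt', h6]
      · have hd := ha.dR t' h1' h3' (by rw [h2', h5'])
        rw [h2', h5', heq] at hd
        simp [h1j, heq, hd, hG]
      · have h6 := hcount0 Label.right fun u hu huy hul => by
          obtain ⟨u', h1u, h2u, h3u, h4u, h5u⟩ := ha.qR_some u hu hul
          rw [hblock u huy] at h5u
          linarith
        have : ¬ (a.qR j < y ∨ (y = a.qR j ∧ a.dR j ≤ P.count (y, Label.inside))) := by
          rintro (h | ⟨h, -⟩) <;> linarith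
        constructor
        · exact fun h => absurd h.2 this
        · omega
    · push Not at hex
      have h6 := hcount0 Label.right fun u hu huy hul => hex u hu (hblock u huy) hul
      constructor
      · rintro ⟨h1, h2⟩
        exfalso
        have h3 := hs.border_le_span (i := j) h1
        have h4 := hbr h1
        have h5 : (span s : ℝ) ≤ a.qR j := by exact_mod_cast ha.qR_none j hj1 h1 hex
        change _ ≤ border s k j at h4
        rcases h2 with h2 | ⟨h2, -⟩ <;> linarith
      · omega
  simp only [labelOf]
  rw [hxy, hj, count_ne_left_proj, count_inside_proj, ← hP]
  simp only [hleft]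
  by_cases hc : G.count (y, Label.inside) + G.count (y, Label.right) ≤
        P.count (y, Label.inside) + P.count (y, Label.right)
  · simp only [hc, if_true]
  · simp only [hc, if_false, hright hc]

end

/-- The requests with the labels that DIVIDE gives to them (the servers are left out). -/
def labelLog (s : List ℝ) (k : ℕ) (a : DivideAdvice) (r : List ℝ) : List Served :=
  r.foldl (fun log x => log ++ [⟨x, labelOf s k a log x, 0⟩]) []

theorem labelLog_append (s : List ℝ) (k : ℕ) (a : DivideAdvice) (r : List ℝ) (x : ℝ) :
    labelLog s k a (r ++ [x]) =
      labelLog s k a r ++ [⟨x, labelOf s k a (labelLog s k a r) x, 0⟩] := by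
  simp [labelLog]

theorem map_pos_labelLog (s : List ℝ) (k : ℕ) (a : DivideAdvice) (r : List ℝ) :
    (labelLog s k a r).map Served.pos = r := by
  induction r using List.reverseRecOn with
  | nil => rfl
  | append_singleton r x ih => simp [labelLog_append, ih]

section

variable {s ys : List ℝ} {k : ℕ}

/-- After a prefix `p` of the requests, the first requests at each position are unmarked, then come
those marked right, then those marked left. -/
theorem count_labelLog (hs : IsLine s k) (hy : IsPositions s ys) {a : DivideAdvice}
    (ha : Describes s k ys a) {r p : List ℝ} (hr : ys.Perm (r.map (trunc s))) (hp : p <+: r) :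
    (∀ y, ((labelLog s k a p).map (Served.proj s)).count (y, Label.inside) =
      min ((p.map (trunc s)).count y) ((pairList s k ys).count (y, Label.inside)) ∧
      ((labelLog s k a p).map (Served.proj s)).count (y, Label.inside) +
        ((labelLog s k a p).map (Served.proj s)).count (y, Label.right) =
      min ((p.map (trunc s)).count y) ((pairList s k ys).count (y, Label.inside) +
        (pairList s k ys).count (y, Label.right))) ∧
    (labelLog s k a p).Pairwise fun e e' =>
      e.label = Label.left → e'.label = Label.right → trunc s e.pos ≠ trunc s e'.pos := by
  induction p using List.reverseRecOn with
  | nil => simp [labelLog]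
  | append_singleton p x ih =>
    obtain ⟨h1, h2⟩ := ih ((List.prefix_append p [x]).trans hp)
    have htot : ∀ y, (((labelLog s k a p).map (Served.proj s)).map Prod.fst).count y =
        (p.map (trunc s)).count y := by
      intro y
      congr 1
      conv_rhs => rw [← map_pos_labelLog s k a p]
      simp [Served.proj, Function.comp_def]
    have hlt : (((labelLog s k a p).map (Served.proj s)).map Prod.fst).count (trunc s x) <
        ((pairList s k ys).map Prod.fst).count (trunc s x) := by
      rw [htot, hy.map_fst_pairList, hr.count_eq]
      obtain ⟨q, rfl⟩ := hp
      simp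
    have hlab := labelOf_eq hs hy ha (labelLog s k a p) x rfl rfl hlt
    rw [htot] at hlt
    have hx := h1 (trunc s x)
    have htx := htot (trunc s x)
    rw [count_map_fst] at htx
    constructor
    · intro y
      rw [labelLog_append]
      by_cases hxy : trunc s x = y
      · subst hxy
        split_ifs at hlab with h3 h4 <;>
        simp [hlab, Served.proj] <;> omega
      · have := h1 y
        simpa [List.count_singleton, Served.proj, hxy] using this
    · rw [labelLog_append, List.pairwise_append]
      refine ⟨h2, List.pairwise_singleton _ _, ?_⟩
      intro e he e' he' hel her
      obtain rfl := List.mem_singleton.1 he'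
      intro hee
      -- A left label given earlier at this position means that the inside and right labels there
      -- are used up, so the new label cannot be right.
      have h3 : 0 < ((labelLog s k a p).map (Served.proj s)).count (trunc s x, Label.left) := by
        rw [List.count_pos_iff, List.mem_map]
        exact ⟨e, he, by rw [Served.proj, hel, hee]⟩
      simp only [hlab] at her
      split_ifs at her with h4 h5
      omega

/-- DIVIDE gives out the same labels as the sorted matching, so that there is an optimal matching
for which its labels are right. -/
theorem exists_matching_labelLog (hs : IsLine s k) (hy : IsPositions s ys) {a : DivideAdvice}
    (ha : Describes s k ys a) {r : List ℝ} (hr : ys.Perm (r.map (trunc s))) :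
    ∃ Z : List (Served × ℕ), Z.map Prod.fst = labelLog s k a r ∧
      (Z.map Prod.snd).Perm (List.range s.length) ∧
      (∀ z ∈ Z, ys.getD z.2 0 = trunc s z.1.pos ∧ pairLabel s k ys z.2 = z.1.label) := by
  have hperm : ((labelLog s k a r).map (Served.proj s)).Perm (pairList s k ys) := by
    rw [List.perm_iff_count]
    rintro ⟨y, b⟩
    obtain ⟨h1, h2⟩ := (count_labelLog hs hy ha hr List.prefix_rfl).1 y
    have h3 := count_map_fst (pairList s k ys) y
    have h4 := count_map_fst ((labelLog s k a r).map (Served.proj s)) y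
    have h5 : ((labelLog s k a r).map (Served.proj s)).map Prod.fst = r.map (trunc s) := by
      conv_rhs => rw [← map_pos_labelLog s k a r]
      simp [Served.proj, Function.comp_def]
    rw [hy.map_fst_pairList, hr.count_eq] at h3
    rw [h5] at h4
    cases b <;> omega
  -- The labels at each position agree in number, so the indices of the sorted list can be
  -- rearranged to follow the order of arrival; `m` is the resulting list of partners.
  obtain ⟨m, hm, hmap⟩ := exists_perm_map_eq hperm
  have hlen : (labelLog s k a r).length = m.length := by
    have := congrArg List.length hmap
    simpa using this.symm
  refine ⟨(labelLog s k a r).zip m, List.map_fst_zip hlen.le, ?_, ?_⟩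
  · rw [List.map_snd_zip hlen.ge]; exact hm
  · intro z hz
    obtain ⟨i, hi, rfl⟩ := List.getElem_of_mem hz
    rw [List.length_zip] at hi
    have := congrArg (fun l => l[i]?) hmap
    simp only [List.getElem?_map] at this
    rw [List.getElem?_eq_getElem (by omega), List.getElem?_eq_getElem (by omega)] at this
    simp only [Option.map_some, Option.some.injEq, Served.proj, Prod.mk.injEq] at this
    simpa using this

/-! ### The advice -/

/-- A maximum with default value `d` for an empty index set, given by just the properties that
`Describes` needs. It supplies `qL`; the version with minimum supplies `qR`. -/
theorem exists_extremal {n : ℕ} (Q : ℕ → Prop) (f : ℕ → ℕ) (d : ℕ) :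
    ∃ m, ((∀ t < n, ¬ Q t) → m = d) ∧ ∀ t < n, Q t → ∃ t' < n, Q t' ∧ f t ≤ f t' ∧ f t' = m := by
  classical
  rcases ((Finset.range n).filter Q).eq_empty_or_nonempty with h | h
  · refine ⟨d, fun _ => rfl, fun t ht hQ => ?_⟩
    have : t ∈ (Finset.range n).filter Q := by simp [ht, hQ]
    simp [h] at this
  · obtain ⟨t', ht', hmax⟩ := Finset.exists_max_image _ f h
    rw [Finset.mem_filter, Finset.mem_range] at ht'
    exact ⟨f t', fun h0 => absurd ht'.2 (h0 t' ht'.1), fun t ht hQ =>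
      ⟨t', ht'.1, ht'.2, hmax t (by simp [ht, hQ]), rfl⟩⟩

theorem exists_extremal_min {n : ℕ} (Q : ℕ → Prop) (f : ℕ → ℕ) (d : ℕ) :
    ∃ m, ((∀ t < n, ¬ Q t) → m = d) ∧ ∀ t < n, Q t → ∃ t' < n, Q t' ∧ f t' ≤ f t ∧ f t' = m := by
  classical
  rcases ((Finset.range n).filter Q).eq_empty_or_nonempty with h | h
  · refine ⟨d, fun _ => rfl, fun t ht hQ => ?_⟩
    have : t ∈ (Finset.range n).filter Q := by simp [ht, hQ]
    simp [h] at this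
  · obtain ⟨t', ht', hmin⟩ := Finset.exists_min_image _ f h
    rw [Finset.mem_filter, Finset.mem_range] at ht'
    exact ⟨f t', fun h0 => absurd ht'.2 (h0 t' ht'.1), fun t ht hQ =>
      ⟨t', ht'.1, ht'.2, hmin t (by simp [ht, hQ]), rfl⟩⟩

/-- The defaults `0` and all-ones are never genuine positions: a request labelled left lies beyond a
border, hence beyond `1`, and one labelled right is at most a border, hence at most `N - 1`, while
the all-ones word is at least `N`. So the counts are read exactly for the blocks that have such
requests, and the number `0` used for the others is correct. -/
theorem exists_tape_describes (hs : IsLine s k) (hy : IsPositions s ys) :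
    ∃ (tape : ℕ → Bool) (a : DivideAdvice),
      (readAdvice s k).eval tape = a ∧ Describes s k ys a := by
  classical
  set n := s.length with hn
  have hnat : ∀ t, ∃ m : ℕ, t < n → m ≤ span s ∧ ys.getD t 0 = m := by
    intro t
    by_cases ht : t < n
    · obtain ⟨m, hm⟩ := hy.nat t ht
      exact ⟨m, fun _ => hm⟩
    · exact ⟨0, fun h => absurd h ht⟩
  choose f hf using hnat
  set w := Nat.log 2 (span s) + 1 with hw
  have hspan : span s < 2 ^ w := Nat.lt_pow_succ_log_self (by norm_num) _
  have hnw : n < 2 ^ (Nat.log 2 n + 1) := Nat.lt_pow_succ_log_self (by norm_num) _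
  choose qL hqL0 hqL using fun j => exists_extremal (n := n)
    (fun t => pairBlock s k ys t = j ∧ pairLabel s k ys t = Label.left) f 0
  choose qR hqR0 hqR using fun j => exists_extremal_min (n := n)
    (fun t => pairBlock s k ys t = j ∧ pairLabel s k ys t = Label.right) f (2 ^ w - 1)
  have hGlen : (pairList s k ys).length = n := by simp [pairList, hn]
  have hcard : ∀ (Q : ℕ → Prop) [DecidablePred Q], ((Finset.range n).filter Q).card ≤ n := by
    intro Q _
    simpa using Finset.card_filter_le (Finset.range n) Q
  have hcnt : ∀ y, (pairList s k ys).count (y, Label.inside) +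
      (pairList s k ys).count (y, Label.right) ≤ n := by
    intro y
    have h1 := count_map_fst (pairList s k ys) y
    have h2 := List.count_le_length (a := y) (l := (pairList s k ys).map Prod.fst)
    rw [List.length_map, hGlen] at h2
    omega
  obtain ⟨tape, a, htape, haL, haR⟩ := exists_tape_readAdvice s k
    { qL := qL
      qR := qR
      dR := fun j => (pairList s k ys).count ((qR j : ℝ), Label.inside)
      mR := fun j => ((Finset.range n).filter fun t =>
        pairBlock s k ys t = j ∧ blockEnd n k j ≤ t).card
      dL := fun j => (pairList s k ys).count ((qL j : ℝ), Label.inside) +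
        (pairList s k ys).count ((qL j : ℝ), Label.right)
      mL := fun j => ((Finset.range n).filter fun t =>
        pairBlock s k ys t = j ∧ t < blockEnd n k (j - 1)).card }
    (by
      intro j
      by_cases h : ∃ t < n, pairBlock s k ys t = j ∧ pairLabel s k ys t = Label.left
      · obtain ⟨t, ht, hQ⟩ := h
        obtain ⟨t', ht', -, -, h1⟩ := hqL j t ht hQ
        exact h1.symm.trans_lt ((hf t' ht').1.trans_lt hspan)
      · push Not at h
        have := hqL0 j (fun t ht hQ => h t ht hQ.1 hQ.2)
        simp [this])
    (by
      intro j
      by_cases h : ∃ t < n, pairBlock s k ys t = j ∧ pairLabel s k ys t = Label.right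
      · obtain ⟨t, ht, hQ⟩ := h
        obtain ⟨t', ht', -, -, h1⟩ := hqR j t ht hQ
        exact h1.symm.trans_lt ((hf t' ht').1.trans_lt hspan)
      · push Not at h
        have := hqR0 j (fun t ht hQ => h t ht hQ.1 hQ.2)
        simp only [this, ← hw]
        omega)
    (fun j => lt_of_le_of_lt ((Nat.le_add_right _ _).trans (hcnt _)) hnw)
    (fun j => (hcard _).trans_lt hnw) (fun j => (hcnt _).trans_lt hnw)
    (fun j => (hcard _).trans_lt hnw)
  simp only [← hw] at haL haR
  have hleftk : ∀ t < n, pairLabel s k ys t = Label.left →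
      1 < pairBlock s k ys t ∧ pairBlock s k ys t ≤ k ∧ 0 < qL (pairBlock s k ys t) := by
    intro t ht hl
    have h1 := one_lt_pairBlock_of_left hl
    have h2 := (pairBlock_mem (ys := ys) hs t).2
    refine ⟨h1, h2, ?_⟩
    obtain ⟨t', ht', ⟨hb, -⟩, -, h3⟩ := hqL _ t ht ⟨rfl, hl⟩
    have h4 := (IsLine.blockOf_spec (s := s) hs.pos (ys.getD t' 0)).2.2.1
    rw [show blockOf s k (ys.getD t' 0) = pairBlock s k ys t from hb] at h4
    have h5 := hs.one_le_border (i := pairBlock s k ys t - 1) (by omega) (by omega)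
    have h6 := h4 h1
    rw [(hf t' ht').2, h3] at h6
    have : (0 : ℝ) < qL (pairBlock s k ys t) := by linarith
    exact_mod_cast this
  have hrightk : ∀ t < n, pairLabel s k ys t = Label.right →
      0 < pairBlock s k ys t ∧ pairBlock s k ys t < k ∧
        qR (pairBlock s k ys t) ≠ 2 ^ w - 1 := by
    intro t ht hl
    have h1 := pairBlock_lt_of_right hs ht hl
    have h2 := (pairBlock_mem (ys := ys) hs t).1
    refine ⟨h2, h1, ?_⟩
    obtain ⟨t', ht', ⟨hb, -⟩, -, h3⟩ := hqR _ t ht ⟨rfl, hl⟩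
    have h4 := (IsLine.blockOf_spec (s := s) hs.pos (ys.getD t' 0)).2.2.2
    rw [show blockOf s k (ys.getD t' 0) = pairBlock s k ys t from hb] at h4
    have h5 := hs.border_le_span (i := pairBlock s k ys t) h1
    have h6 := h4 h1
    rw [(hf t' ht').2, h3] at h6
    have : (qR (pairBlock s k ys t) : ℝ) + 1 ≤ span s := by linarith
    have : qR (pairBlock s k ys t) + 1 ≤ span s := by exact_mod_cast this
    omega
  refine ⟨tape, a, htape, ⟨?_, ?_, ?_, ?_, ?_, ?_, ?_, ?_⟩⟩
  · intro j h1 h2 h3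
    rw [(haL j h1 h2).1]
    exact hqL0 j fun t ht hQ => h3 t ht hQ.1 hQ.2
  · intro t ht hl
    obtain ⟨t', ht', ⟨h1, h2⟩, h3, h4⟩ := hqL _ t ht ⟨rfl, hl⟩
    obtain ⟨h5, h6, h7⟩ := hleftk t ht hl
    refine ⟨t', ht', h1, h2, ?_, ?_⟩
    · rw [(hf t ht).2, (hf t' ht').2]; exact_mod_cast h3
    · rw [(haL _ h5 h6).1, (hf t' ht').2, h4]
  · intro t ht hl h0
    obtain ⟨h5, h6, h7⟩ := hleftk t ht hl
    rw [((haL _ h5 h6).2.1 h7).1, h0, (haL _ h5 h6).1]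
  · intro j h1 h2 h3
    rw [(haR j h1 h2).1, hqR0 j fun t ht hQ => h3 t ht hQ.1 hQ.2]
    omega
  · intro t ht hl
    obtain ⟨t', ht', ⟨h1, h2⟩, h3, h4⟩ := hqR _ t ht ⟨rfl, hl⟩
    obtain ⟨h5, h6, h7⟩ := hrightk t ht hl
    refine ⟨t', ht', h1, h2, ?_, ?_⟩
    · rw [(hf t ht).2, (hf t' ht').2]; exact_mod_cast h3
    · rw [(haR _ h5 h6).1, (hf t' ht').2, h4]
  · intro t ht hl h0
    obtain ⟨h5, h6, h7⟩ := hrightk t ht hl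
    rw [((haR _ h5 h6).2.1 h7).1, h0, (haR _ h5 h6).1]
  · intro j h1 h2
    by_cases h : ∃ t < n, pairBlock s k ys t = j ∧ pairLabel s k ys t = Label.left
    · obtain ⟨t, ht, rfl, hl⟩ := h
      exact ((haL _ h1 h2).2.1 (hleftk t ht hl).2.2).2
    · rw [(haL j h1 h2).2.2 (hqL0 j fun t ht hQ => h ⟨t, ht, hQ⟩)]
      symm
      rw [Finset.card_eq_zero, Finset.filter_eq_empty_iff]
      rintro t ht ⟨rfl, h3⟩
      exact h ⟨t, Finset.mem_range.1 ht, rfl, pairLabel_eq_left.2 h3⟩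
  · intro j h1 h2
    by_cases h : ∃ t < n, pairBlock s k ys t = j ∧ pairLabel s k ys t = Label.right
    · obtain ⟨t, ht, rfl, hl⟩ := h
      exact ((haR _ h1 h2).2.1 (hrightk t ht hl).2.2).2
    · rw [(haR j h1 h2).2.2 (hqR0 j fun t ht hQ => h ⟨t, ht, hQ⟩)]
      symm
      rw [Finset.card_eq_zero, Finset.filter_eq_empty_iff]
      rintro t ht ⟨rfl, h3⟩
      exact h ⟨t, Finset.mem_range.1 ht, rfl, pairLabel_eq_right.2 h3⟩

end

/-! ### The run of DIVIDE -/

/-- If the continuation ignores the tape, it does not matter where `p` stopped reading. DIVIDE is of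
this kind, as it reads nothing after the advice. -/
theorem BitReader.eval_bind_of_forall {β γ : Type} {p : BitReader β} {f : β → BitReader γ}
    {g : β → γ} (h : ∀ v t, (f v).eval t = g v) (t : ℕ → Bool) :
    (p >>= f).eval t = g (p.eval t) := by
  change (p.bind f).eval t = _
  induction p generalizing t with
  | done v => exact h v t
  | read next ih => exact ih _ _

/-- The requests served by DIVIDE with advice `a`, with their labels and servers. -/
def divideLog (A : OnlineAlg) (s : List ℝ) (k : ℕ) (a : DivideAdvice) (r : List ℝ) :
    List Served :=
  r.foldl (fun log x => log ++ [⟨x, labelOf s k a log x, divideServe A s k a log x⟩]) []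

theorem divideLog_append (A : OnlineAlg) (s : List ℝ) (k : ℕ) (a : DivideAdvice) (r : List ℝ)
    (x : ℝ) : divideLog A s k a (r ++ [x]) = divideLog A s k a r ++
      [⟨x, labelOf s k a (divideLog A s k a r) x, divideServe A s k a (divideLog A s k a r) x⟩] := by
  simp [divideLog]

theorem eval_serveFrom_divide (k : ℕ) (A : OnlineAlg) (s : List ℝ) (a : DivideAdvice)
    (log : List Served) (r : List ℝ) (t : ℕ → Bool) :
    log.map Served.server ++ ((divide k A).serveFrom (⟨s, a, log⟩ : DivideState) r).eval t =
      (r.foldl (fun log x => log ++ [⟨x, labelOf s k a log x, divideServe A s k a log x⟩])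
        log).map Served.server := by
  induction r generalizing log t with
  | nil => simp [AdviceAlg.serveFrom, BitReader.eval_pure]
  | cons x r ih =>
    rw [List.foldl_cons, ← ih _ t]
    have : ∀ (p : BitReader (List ℕ)) (j : ℕ),
        (p >>= fun σ => (pure (j :: σ) : BitReader (List ℕ))).eval t = j :: p.eval t := fun p j =>
      BitReader.eval_bind_of_forall (g := fun σ => j :: σ) (fun _ _ => rfl) t
    refine (congrArg (log.map Served.server ++ ·) (this _ _)).trans ?_
    simp

theorem eval_run_divide (k : ℕ) (A : OnlineAlg) (s r : List ℝ) (t : ℕ → Bool) :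
    ((divide k A).run s r).eval t =
      (divideLog A s k ((readAdvice s k).eval t) r).map Served.server := by
  have h : ∀ a t, ((divide k A).serveFrom (⟨s, a, []⟩ : DivideState) r).eval t =
      (divideLog A s k a r).map Served.server := fun a t => by
    simpa [divideLog] using eval_serveFrom_divide k A s a [] r t
  have h3 : (divide k A).run s r = readAdvice s k >>=
      fun a => (divide k A).serveFrom (⟨s, a, []⟩ : DivideState) r := by
    change BitReader.bind (BitReader.bind _ _) _ = BitReader.bind _ _
    induction readAdvice s k with
    | done v => rfl
    | read next ih => exact congrArg BitReader.read (funext ih)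
  rw [h3]
  exact BitReader.eval_bind_of_forall (g := fun a => (divideLog A s k a r).map Served.server) h t

theorem bits_run_divide_le (k : ℕ) (A : OnlineAlg) (s r : List ℝ) (t : ℕ → Bool) :
    ((divide k A).run s r).bits t ≤
      (k - 1) * (2 * (Nat.log 2 (span s) + 1) + 4 * (Nat.log 2 s.length + 1)) := by
  have h : ∀ (r : List ℝ) (st : DivideState) t, ((divide k A).serveFrom st r).bits t ≤ 0 := by
    intro r
    induction r with
    | nil => exact fun st t => BitReader.bits_pure_le _ t
    | cons x r ih =>
      intro st t
      exact BitReader.bits_bind_le (a := 0) (b := 0) (fun t => ih _ t)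
        (fun _ => BitReader.bits_pure_le _) t
  exact BitReader.bits_bind_le (b := 0)
    (BitReader.bits_bind_le (b := 0) (bits_readAdvice_le s k) fun _ => BitReader.bits_pure_le _)
    (fun st => h r st) t

/-- Forgetting the server of a served request. -/
def Served.erase (e : Served) : Served := ⟨e.pos, e.label, 0⟩

/-- Labels depend on the positions and labels of earlier requests, never on their servers, and so
are the same for every subroutine `A`. -/
theorem labelOf_map_erase (s : List ℝ) (k : ℕ) (a : DivideAdvice) (log : List Served) (x : ℝ) :
    labelOf s k a (log.map Served.erase) x = labelOf s k a log x := by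
  simp only [labelOf, count_ne_left_proj, count_inside_proj, List.map_map]
  rfl

theorem map_erase_divideLog (A : OnlineAlg) (s : List ℝ) (k : ℕ) (a : DivideAdvice) (r : List ℝ) :
    (divideLog A s k a r).map Served.erase = labelLog s k a r := by
  induction r using List.reverseRecOn with
  | nil => rfl
  | append_singleton r x ih =>
    rw [divideLog_append, labelLog_append, List.map_append, ih, ← ih, labelOf_map_erase]
    rfl

theorem map_pos_divideLog (A : OnlineAlg) (s : List ℝ) (k : ℕ) (a : DivideAdvice) (r : List ℝ) :
    (divideLog A s k a r).map Served.pos = r := by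
  conv_rhs => rw [← map_pos_labelLog s k a r, ← map_erase_divideLog A s k a r, List.map_map]
  rfl

/-- The unmarked servers of block `j`. -/
def insideServers (s : List ℝ) (k : ℕ) (a : DivideAdvice) (j : ℕ) : List ℕ :=
  (List.range s.length).filter (fun i =>
    decide (blockEnd s.length k (j - 1) ≤ i ∧ i < blockEnd s.length k j ∧ i ∉ marked s k a))

/-- The positions of the unmarked servers of block `j`. -/
def insidePositions (s : List ℝ) (k : ℕ) (a : DivideAdvice) (j : ℕ) : List ℝ :=
  (insideServers s k a j).map (fun i => s.getD i 0)

/-- A served request is an unmarked request of block `j`. -/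
def Served.IsInside (s : List ℝ) (k j : ℕ) (e : Served) : Prop :=
  e.label = Label.inside ∧ blockOf s k e.pos = j

instance (s : List ℝ) (k j : ℕ) : DecidablePred (Served.IsInside s k j) := fun e =>
  inferInstanceAs (Decidable (e.label = Label.inside ∧ blockOf s k e.pos = j))

/-- The unmarked requests of block `j`. -/
def insideRequests (s : List ℝ) (k : ℕ) (a : DivideAdvice) (r : List ℝ) (j : ℕ) : List ℝ :=
  ((labelLog s k a r).filter fun e => decide (e.IsInside s k j)).map Served.pos

theorem map_pos_filter_divideLog (A : OnlineAlg) (s : List ℝ) (k : ℕ) (a : DivideAdvice)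
    (r : List ℝ) (j : ℕ) :
    ((divideLog A s k a r).filter fun e => decide (e.IsInside s k j)).map Served.pos =
      insideRequests s k a r j := by
  rw [insideRequests, ← map_erase_divideLog A s k a r, List.filter_map, List.map_map]
  rfl

theorem runServe_append (serve : List ℝ → List ℝ → ℝ → ℕ) (s r : List ℝ) (x : ℝ) :
    runServe serve s (r ++ [x]) = runServe serve s r ++ [serve s r x] := by
  simp only [runServe, List.mapIdx_append, List.mapIdx_singleton]
  congr 1
  · apply List.ext_getElem
    · simp
    · intro i h1 h2
      simp only [List.length_mapIdx] at h1
      simp [List.take_append_of_le_length h1.le]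
  · simp

/-- At each unmarked request of the block, `A` is shown exactly the earlier unmarked requests of
that block. Its answers therefore form a genuine run on the subinput, up to translating server
indices. -/
theorem map_server_inside (A : OnlineAlg) (s : List ℝ) (k : ℕ) (a : DivideAdvice) (r : List ℝ)
    (j : ℕ) :
    ((divideLog A s k a r).filter fun e => decide (e.IsInside s k j)).map Served.server =
      (A.run (insidePositions s k a j) (insideRequests s k a r j)).map
        (fun i => (insideServers s k a j).getD i 0) := by
  rw [← map_pos_filter_divideLog A]
  induction r using List.reverseRecOn with
  | nil => rfl
  | append_singleton r x ih =>
    rw [divideLog_append, List.filter_append, List.map_append, List.map_append]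
    by_cases hx : labelOf s k a (divideLog A s k a r) x = Label.inside ∧ blockOf s k x = j
    · obtain ⟨h1, h2⟩ := hx
      have h3 : ([⟨x, labelOf s k a (divideLog A s k a r) x,
          divideServe A s k a (divideLog A s k a r) x⟩] : List Served).filter
            (fun e => decide (e.IsInside s k j)) = [⟨x, labelOf s k a (divideLog A s k a r) x,
          divideServe A s k a (divideLog A s k a r) x⟩] := by
        simp [Served.IsInside, h1, h2]
      rw [h3, ih]
      simp only [OnlineAlg.run, List.map_cons, List.map_nil, runServe_append, List.map_append]
      congr 2
      simp only [divideServe, h1, serveInside, h2]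
      rfl
    · have h3 : ([⟨x, labelOf s k a (divideLog A s k a r) x,
          divideServe A s k a (divideLog A s k a r) x⟩] : List Served).filter
            (fun e => decide (e.IsInside s k j)) = [] := by
        simp only [List.filter_cons, List.filter_nil, Served.IsInside, hx, decide_false]
        rfl
      rw [h3]
      simpa using ih

theorem lrRun_append (s : List ℝ) (F : Finset ℕ) (l : List (ℝ × Bool)) (q : ℝ × Bool) :
    lrRun s F (l ++ [q]) = lrRun s F l ++
      [(lrServe s (F \ (lrRun s F l).toFinset) q.1).eval (fun _ => q.2)] := by
  induction l generalizing F with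
  | nil => simp [lrRun]
  | cons p l ih =>
    simp only [lrRun, List.cons_append, List.cons.injEq, true_and, ih, List.toFinset_cons]
    rw [show ∀ (u : ℕ) (X : Finset ℕ), F.erase u \ X = F \ insert u X from fun u X => by
      ext i
      simp only [Finset.mem_sdiff, Finset.mem_erase, Finset.mem_insert]
      tauto]

/-- The position of a marked request and the bit that LR gets for it. -/
def Served.bit (e : Served) : ℝ × Bool := (e.pos, decide (e.label = Label.right))

/-- DIVIDE removes from the marked servers those used by any earlier request, LR only those used by
marked ones. By `hr` unmarked requests take no marked server, so the free sets agree. -/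
theorem map_server_marked (A : OnlineAlg) (s : List ℝ) (k : ℕ) (a : DivideAdvice) (r : List ℝ)
    (hr : ∀ e ∈ divideLog A s k a r, e.label = Label.inside → e.server ∉ marked s k a) :
    ((divideLog A s k a r).filter fun e => decide (¬ e.label = Label.inside)).map Served.server =
      lrRun s (marked s k a)
        (((divideLog A s k a r).filter fun e =>
          decide (¬ e.label = Label.inside)).map Served.bit) := by
  induction r using List.reverseRecOn with
  | nil => rfl
  | append_singleton r x ih =>
    rw [divideLog_append] at hr ⊢
    have hr' : ∀ e ∈ divideLog A s k a r, e.label = Label.inside → e.server ∉ marked s k a :=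
      fun e he => hr e (by simp [he])
    specialize ih hr'
    have hfree : marked s k a \ ((divideLog A s k a r).map Served.server).toFinset =
        marked s k a \ (((divideLog A s k a r).filter fun e =>
          decide (¬ e.label = Label.inside)).map Served.server).toFinset := by
      ext i
      simp only [Finset.mem_sdiff, List.mem_toFinset, List.mem_map, List.mem_filter,
        decide_eq_true_eq, not_exists, not_and]
      constructor
      · exact fun h => ⟨h.1, fun e he => h.2 e he.1⟩
      · rintro ⟨h1, h2⟩
        refine ⟨h1, fun e he hei => ?_⟩
        by_cases hin : e.label = Label.inside
        · exact hr' e he hin (hei ▸ h1)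
        · exact h2 e ⟨he, hin⟩ hei
    rw [List.filter_append, List.map_append, List.map_append]
    cases hx : labelOf s k a (divideLog A s k a r) x with
    | inside => simpa using ih
    | left =>
      simp only [List.filter_cons, List.filter_nil, reduceCtorEq, not_false_eq_true, decide_true,
        if_true, List.map_cons, List.map_nil, lrRun_append, ← ih]
      congr 2
      simp only [divideServe, hx, serveMarked, hfree]
      rfl
    | right =>
      simp only [List.filter_cons, List.filter_nil, reduceCtorEq, not_false_eq_true, decide_true,
        if_true, List.map_cons, List.map_nil, lrRun_append, ← ih]
      congr 2
      simp only [divideServe, hx, serveMarked, hfree]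
      rfl

/-! ### Costs -/

theorem map_getD_range (l : List ℝ) : (List.range l.length).map (fun i => l.getD i 0) = l := by
  apply List.ext_getElem
  · simp
  · intro i h1 h2
    simp [h2]

theorem cost_nonneg (s r : List ℝ) (σ : List ℕ) : 0 ≤ cost s r σ := by
  apply List.sum_nonneg
  intro x hx
  obtain ⟨i, hi, rfl⟩ := List.getElem_of_mem hx
  simp

theorem opt_le_cost {s r : List ℝ} {σ : List ℕ} (h : IsMatching s.length σ) :
    opt s r ≤ cost s r σ :=
  csInf_le ⟨0, by rintro x ⟨σ, -, rfl⟩; exact cost_nonneg s r σ⟩ ⟨σ, h, rfl⟩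

theorem le_opt {s r : List ℝ} {x : ℝ} (h : ∀ σ, IsMatching s.length σ → x ≤ cost s r σ) :
    x ≤ opt s r :=
  le_csInf ⟨_, List.range s.length, List.Perm.refl _, rfl⟩ (by rintro _ ⟨σ, hσ, rfl⟩; exact h σ hσ)

theorem opt_nonneg (s r : List ℝ) : 0 ≤ opt s r := le_opt fun σ _ => cost_nonneg s r σ

theorem cost_map_map {α : Type*} (s : List ℝ) (l : List α) (f : α → ℝ) (g : α → ℕ) :
    cost s (l.map f) (l.map g) = (l.map fun a => |f a - s.getD (g a) 0|).sum := by
  rw [cost, List.zipWith_map, List.zipWith_self]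

theorem zipWith_congr_of_mem {α β γ : Type*} {f g : α → β → γ} (l : List α) {l' : List β}
    (h : ∀ x, ∀ j ∈ l', f x j = g x j) : List.zipWith f l l' = List.zipWith g l l' := by
  induction l generalizing l' with
  | nil => rfl
  | cons a l ih =>
    cases l' with
    | nil => rfl
    | cons b l' =>
      rw [List.zipWith_cons_cons, List.zipWith_cons_cons, h a b (by simp),
        ih fun x j hj => h x j (by simp [hj])]

/-- Passing from a list `V` of servers to the list of their positions does not change the cost. -/
theorem cost_map_getD (s : List ℝ) (V : List ℕ) (r : List ℝ) {σ : List ℕ}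
    (h : ∀ i ∈ σ, i < V.length) :
    cost (V.map fun i => s.getD i 0) r σ = cost s r (σ.map fun i => V.getD i 0) := by
  rw [cost, cost, List.zipWith_map_right]
  congr 1
  apply zipWith_congr_of_mem
  intro x j hj
  simp [h j hj]

/-- A matching with the servers `V` is a matching of the instance with these servers only. -/
theorem opt_map_le {α : Type*} (s : List ℝ) {V : List ℕ} (hV : V.Nodup) (l : List α)
    (f : α → ℝ) (g : α → ℕ) (h : (l.map g).Perm V) :
    opt (V.map fun i => s.getD i 0) (l.map f) ≤ (l.map fun a => |f a - s.getD (g a) 0|).sum := by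
  have hmem : ∀ a ∈ l, g a ∈ V := fun a ha => h.mem_iff.1 (List.mem_map_of_mem ha)
  have hσ : (l.map fun a => V.idxOf (g a)).Perm (List.range V.length) := by
    have h1 : (l.map fun a => V.idxOf (g a)) = (l.map g).map V.idxOf := by simp
    rw [h1]
    refine (h.map _).trans (List.Perm.of_eq ?_)
    apply List.ext_getElem
    · simp
    · intro i h1 h2
      simp [hV.idxOf_getElem]
  have h2 := opt_le_cost (s := V.map fun i => s.getD i 0) (r := l.map f)
    (σ := l.map fun a => V.idxOf (g a)) (by rw [List.length_map]; exact hσ)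
  rw [cost_map_getD s V (l.map f) (fun i hi => List.mem_range.1 (hσ.mem_iff.1 hi)), List.map_map,
    cost_map_map] at h2
  refine h2.trans (le_of_eq ?_)
  congr 1
  apply List.map_congr_left
  intro a ha
  have : V.getD (V.idxOf (g a)) 0 = g a := by
    rw [List.getD_eq_getElem _ _ (List.idxOf_lt_length_of_mem (hmem a ha))]
    simp
  simp only [Function.comp, this]

/-- The truncated point lies between `x` and every server, because the servers lie in `[1, N - 1]`.
-/
theorem IsLine.abs_sub_eq {s : List ℝ} {k : ℕ} (hs : IsLine s k) (x : ℝ) {j : ℕ}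
    (hj : j < s.length) :
    |x - s.getD j 0| = |x - trunc s x| + |trunc s x - s.getD j 0| := by
  have h1 := hs.one_le j hj
  have h2 := hs.le_span j hj
  unfold trunc
  rcases le_total (span s : ℝ) x with h | h
  · rw [min_eq_left h, max_eq_right (by linarith), abs_of_nonneg, abs_of_nonneg, abs_of_nonneg] <;>
    linarith
  · rw [min_eq_right h]
    rcases le_total 0 x with h3 | h3
    · rw [max_eq_right h3]; simp
    · rw [max_eq_left h3, abs_of_nonpos, abs_of_nonpos, abs_of_nonpos] <;> linarith

/-- Every matching that sorts the truncated requests is optimal. -/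
theorem sum_le_opt {s ys r : List ℝ} {k : ℕ} (hs : IsLine s k) (hy : IsPositions s ys)
    (hr : ys.Perm (r.map (trunc s))) (Z : List (Served × ℕ))
    (hZr : Z.map (fun z => z.1.pos) = r) (hZs : (Z.map Prod.snd).Perm (List.range s.length))
    (hZ : ∀ z ∈ Z, ys.getD z.2 0 = trunc s z.1.pos) :
    (Z.map fun z => |z.1.pos - s.getD z.2 0|).sum ≤ opt s r := by
  have hlen : r.length = s.length := by
    have := hr.length_eq
    rw [List.length_map, hy.length] at this
    exact this.symm
  have hZlt : ∀ z ∈ Z, z.2 < s.length := fun z hz =>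
    List.mem_range.1 (hZs.mem_iff.1 (List.mem_map_of_mem hz))
  have h1 : (Z.map fun z => |z.1.pos - s.getD z.2 0|).sum =
      (r.map fun x => |x - trunc s x|).sum +
        ((List.range s.length).map fun t => |ys.getD t 0 - s.getD t 0|).sum := by
    have h2 : ((List.range s.length).map fun t => |ys.getD t 0 - s.getD t 0|).sum =
        (Z.map fun z => |trunc s z.1.pos - s.getD z.2 0|).sum := by
      rw [← (hZs.map fun t => |ys.getD t 0 - s.getD t 0|).sum_eq, List.map_map]
      congr 1
      apply List.map_congr_left
      intro z hz
      simp only [Function.comp, hZ z hz]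
    rw [h2, ← hZr, List.map_map, ← List.sum_map_add]
    congr 1
    apply List.map_congr_left
    intro z hz
    exact hs.abs_sub_eq _ (hZlt z hz)
  rw [h1]
  apply le_opt
  intro σ hσ
  have hσlen : σ.length = s.length := by simpa using hσ.length_eq
  have hfst : (r.zip σ).map Prod.fst = r := List.map_fst_zip (by omega)
  have hsnd : (r.zip σ).map Prod.snd = σ := List.map_snd_zip (by omega)
  have h3 : cost s r σ = (r.map fun x => |x - trunc s x|).sum +
      ((r.zip σ).map fun p => |trunc s p.1 - s.getD p.2 0|).sum := by
    have h4 := cost_map_map s (r.zip σ) Prod.fst Prod.snd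
    have h5 : r.map (fun x => |x - trunc s x|) =
        (r.zip σ).map fun p => |p.1 - trunc s p.1| := by
      conv_lhs => rw [← hfst, List.map_map]
      rfl
    rw [hfst, hsnd] at h4
    rw [h4, h5, ← List.sum_map_add]
    congr 1
    apply List.map_congr_left
    intro p hp
    refine hs.abs_sub_eq _ (List.mem_range.1 (hσ.mem_iff.1 ?_))
    rw [← hsnd]
    exact List.mem_map_of_mem hp
  rw [h3]
  -- The truncation cost is common to both sides; what remains compares the sorted matching of the
  -- truncated requests with an arbitrary one.
  gcongr
  have hperm : ys.Perm (((r.zip σ).map fun p => (trunc s p.1, s.getD p.2 0)).map Prod.fst) := by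
    rw [List.map_map]
    refine hr.trans (List.Perm.of_eq ?_)
    conv_lhs => rw [← hfst, List.map_map]
    rfl
  obtain ⟨l, hl, hlf⟩ := exists_perm_map_eq hperm
  have hls : (l.map Prod.snd).Perm s := by
    refine (hl.map _).trans ?_
    rw [List.map_map]
    have : ((r.zip σ).map (Prod.snd ∘ fun p => (trunc s p.1, s.getD p.2 0))) =
        σ.map fun i => s.getD i 0 := by
      conv_rhs => rw [← hsnd, List.map_map]
      rfl
    rw [this]
    exact (hσ.map _).trans (List.Perm.of_eq (map_getD_range s))
  have h4 := sum_abs_sub_sorted_le (l := l) (by rw [hlf]; exact hy.sorted) hs.sorted hls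
  rw [hlf, (hl.map _).sum_eq, List.map_map] at h4
  refine le_trans (le_of_eq ?_) h4
  conv_rhs => rw [← map_getD_range ys, ← map_getD_range s]
  rw [hy.length, List.zipWith_map, List.zipWith_self]

/-! ### The matching produced by DIVIDE -/

section

variable {s ys r : List ℝ} {k : ℕ} {a : DivideAdvice} {Z : List (Served × ℕ)}

theorem pairBlock_eq (hs : IsLine s k) {z : Served × ℕ}
    (hz : ys.getD z.2 0 = trunc s z.1.pos) : pairBlock s k ys z.2 = blockOf s k z.1.pos := by
  rw [pairBlock, hz, hs.blockOf_trunc]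

/-- An inside label puts the pair into the server block with the number of the request's block, and
server blocks are disjoint. So `A` gets as many requests as servers in each block, and `Z` restricts
to a matching of that input. -/
theorem map_snd_filter_inside_perm (hs : IsLine s k) (hy : IsPositions s ys)
    (ha : Describes s k ys a) (hZs : (Z.map Prod.snd).Perm (List.range s.length))
    (hZ : ∀ z ∈ Z, ys.getD z.2 0 = trunc s z.1.pos ∧ pairLabel s k ys z.2 = z.1.label) (j : ℕ) :
    ((Z.filter fun z => decide (z.1.IsInside s k j)).map Prod.snd).Perm
      (insideServers s k a j) := by
  have hnd : (Z.map Prod.snd).Nodup := hZs.nodup_iff.2 List.nodup_range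
  rw [insideServers, List.perm_ext_iff_of_nodup (hnd.sublist (List.filter_sublist.map _))
    (List.nodup_range.filter _)]
  intro t
  simp only [List.mem_map, List.mem_filter, List.mem_range, decide_eq_true_eq,
    mem_marked_iff hs hy ha]
  constructor
  · rintro ⟨z, ⟨hz, hin, hb⟩, rfl⟩
    have hlt : z.2 < s.length := List.mem_range.1 (hZs.mem_iff.1 (List.mem_map_of_mem hz))
    have hl := (hZ z hz).2.trans hin
    have h1 := pairLabel_eq_inside.1 hl
    rw [pairBlock_eq hs (hZ z hz).1, hb] at h1
    exact ⟨hlt, h1.1, h1.2, fun h => h.2 hl⟩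
  · rintro ⟨hlt, h1, h2, h3⟩
    obtain ⟨z, hz, rfl⟩ := List.mem_map.1 (hZs.mem_iff.2 (List.mem_range.2 hlt))
    have hl : pairLabel s k ys z.2 = Label.inside := by
      by_contra h
      exact h3 ⟨hlt, h⟩
    refine ⟨z, ⟨hz, (hZ z hz).2.symm.trans hl, ?_⟩, rfl⟩
    have h4 := pairLabel_eq_inside.1 hl
    rw [← pairBlock_eq hs (hZ z hz).1]
    have h5 := (pairBlock_mem (ys := ys) hs z.2).1
    by_contra hne
    rcases Nat.lt_or_gt_of_ne hne with h | h
    · have := blockEnd_mono s.length k (show pairBlock s k ys z.2 ≤ j - 1 by omega)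
      omega
    · have := blockEnd_mono s.length k (show j ≤ pairBlock s k ys z.2 - 1 by omega)
      omega

theorem toFinset_filter_marked (hs : IsLine s k) (hy : IsPositions s ys)
    (ha : Describes s k ys a) (hZs : (Z.map Prod.snd).Perm (List.range s.length))
    (hZ : ∀ z ∈ Z, ys.getD z.2 0 = trunc s z.1.pos ∧ pairLabel s k ys z.2 = z.1.label) :
    ((Z.filter fun z => decide (¬ z.1.label = Label.inside)).map Prod.snd).toFinset =
      marked s k a := by
  ext t
  simp only [List.mem_toFinset, List.mem_map, List.mem_filter, decide_eq_true_eq,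
    mem_marked_iff hs hy ha]
  constructor
  · rintro ⟨z, ⟨hz, h⟩, rfl⟩
    exact ⟨List.mem_range.1 (hZs.mem_iff.1 (List.mem_map_of_mem hz)), (hZ z hz).2 ▸ h⟩
  · rintro ⟨hlt, h⟩
    obtain ⟨z, hz, rfl⟩ := List.mem_map.1 (hZs.mem_iff.2 (List.mem_range.2 hlt))
    exact ⟨z, ⟨hz, (hZ z hz).2 ▸ h⟩, rfl⟩

/-- A border separates each marked request from its pair. As blocks are open on the left and closed
on the right, the request is strictly beyond the border for a left label and weakly before it for a
right one, which is the asymmetry built into `IsDirected`. Monotonicity comes from the sorting of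
`ys`, and `order` from right labels being given before left ones. -/
theorem isDirected_filter_marked (hs : IsLine s k) (hy : IsPositions s ys)
    (ha : Describes s k ys a) (hr : ys.Perm (r.map (trunc s)))
    (hZr : Z.map Prod.fst = labelLog s k a r)
    (hZs : (Z.map Prod.snd).Perm (List.range s.length))
    (hZ : ∀ z ∈ Z, ys.getD z.2 0 = trunc s z.1.pos ∧ pairLabel s k ys z.2 = z.1.label) :
    IsDirected s ((Z.filter fun z => decide (¬ z.1.label = Label.inside)).map
      fun z => (z.1.bit, z.2)) := by
  have hlt : ∀ z ∈ Z, z.2 < s.length := fun z hz =>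
    List.mem_range.1 (hZs.mem_iff.1 (List.mem_map_of_mem hz))
  have hbit : ∀ z ∈ Z, ¬ z.1.label = Label.inside → z.1.bit.2 = false →
      z.1.label = Label.left := by
    intro z _ h1 h2
    cases h : z.1.label <;> simp_all [Served.bit]
  have hbit' : ∀ z : Served × ℕ, z.1.bit.2 = true → z.1.label = Label.right := by
    intro z h
    simpa [Served.bit] using h
  have hL : ∀ z ∈ Z, z.1.label = Label.left → ∃ i, 0 < i ∧ i < k ∧
      s.getD z.2 0 ≤ border s k i ∧ border s k i < z.1.pos := by
    intro z hz h
    have h1 := (hZ z hz).2.trans h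
    have h2 := one_lt_pairBlock_of_left h1
    have h3 := pairLabel_eq_left.1 h1
    have h4 := (pairBlock_mem (ys := ys) hs z.2).2
    rw [pairBlock_eq hs (hZ z hz).1] at h2 h3 h4
    exact ⟨blockOf s k z.1.pos - 1, by omega, by omega, hs.le_border (by omega) h3,
      (IsLine.blockOf_spec hs.pos _).2.2.1 h2⟩
  have hR : ∀ z ∈ Z, z.1.label = Label.right → ∃ i < k,
      z.1.pos ≤ border s k i ∧ border s k i ≤ s.getD z.2 0 := by
    intro z hz h
    have h1 := (hZ z hz).2.trans h
    have h2 := pairBlock_lt_of_right hs (hlt z hz) h1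
    have h3 := pairLabel_eq_right.1 h1
    rw [pairBlock_eq hs (hZ z hz).1] at h2 h3
    exact ⟨blockOf s k z.1.pos, h2, (IsLine.blockOf_spec hs.pos _).2.2.2 h2,
      hs.border_le h3 (hlt z hz)⟩
  constructor
  · intro e he hb
    obtain ⟨z, hz, rfl⟩ := List.mem_map.1 he
    simp only [List.mem_filter, decide_eq_true_eq] at hz
    obtain ⟨i, -, -, h1, h2⟩ := hL z hz.1 (hbit z hz.1 hz.2 hb)
    exact h1.trans_lt h2
  · intro e he hb
    obtain ⟨z, hz, rfl⟩ := List.mem_map.1 he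
    simp only [List.mem_filter, decide_eq_true_eq] at hz
    obtain ⟨i, -, h1, h2⟩ := hR z hz.1 (hbit' z hb)
    exact h1.trans h2
  · intro e he e' he' hb hb' hxx
    obtain ⟨z, hz, rfl⟩ := List.mem_map.1 he
    obtain ⟨z', hz', rfl⟩ := List.mem_map.1 he'
    simp only [List.mem_filter, decide_eq_true_eq] at hz hz'
    obtain ⟨i, hi0, hik, h1, h2⟩ := hL z' hz'.1 (hbit z' hz'.1 hz'.2 hb')
    obtain ⟨i', hik', h3, h4⟩ := hR z hz.1 (hbit' z hb)
    have h5 := hs.one_le_border hi0 hik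
    have h6 := hs.border_le_span hik'
    have h7 := hs.border_le_span hik
    change z.1.pos < z'.1.pos at hxx
    -- Truncation preserves this strict inequality, as the request labelled right is at most `N - 1`
    -- and the one labelled left is greater than `1`.
    have htr : trunc s z.1.pos < trunc s z'.1.pos := by
      unfold trunc
      rw [min_eq_right (by linarith : z.1.pos ≤ span s)]
      refine max_lt ?_ ?_
      · exact lt_max_of_lt_right (lt_min (by linarith) (by linarith))
      · exact lt_max_of_lt_right (lt_min (by linarith) hxx)
    refine getD_le_getD hs.sorted ?_ (hlt z' hz'.1)
    by_contra! hgt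
    have := hy.getD_mono hgt.le (hlt z hz.1)
    rw [(hZ z hz.1).1, (hZ z' hz'.1).1] at this
    linarith
  · have h1 := (count_labelLog hs hy ha hr List.prefix_rfl).2
    rw [← hZr, List.pairwise_map] at h1
    rw [List.map_map, List.pairwise_map]
    refine (h1.filter _).imp_of_mem ?_
    intro z z' hz hz' h hb hb' hxx
    simp only [List.mem_filter, decide_eq_true_eq] at hz hz'
    exact h (hbit z hz.1 hz.2 hb) (hbit' z' hb') (congrArg (trunc s) hxx)

theorem insideRequests_eq (hZr : Z.map Prod.fst = labelLog s k a r) (j : ℕ) :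
    insideRequests s k a r j =
      (Z.filter fun z => decide (z.1.IsInside s k j)).map fun z => z.1.pos := by
  rw [insideRequests, ← hZr, List.filter_map, List.map_map]
  rfl

theorem isInput_inside (hs : IsLine s k) (hy : IsPositions s ys)
    (ha : Describes s k ys a) (hZr : Z.map Prod.fst = labelLog s k a r)
    (hZs : (Z.map Prod.snd).Perm (List.range s.length))
    (hZ : ∀ z ∈ Z, ys.getD z.2 0 = trunc s z.1.pos ∧ pairLabel s k ys z.2 = z.1.label) (j : ℕ) :
    IsInput (insidePositions s k a j) (insideRequests s k a r j) := by
  constructor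
  · rw [insidePositions, List.pairwise_map]
    refine (List.pairwise_lt_range.sublist List.filter_sublist).imp_of_mem ?_
    intro i i' _ hi' h
    simp only [List.mem_filter, List.mem_range] at hi'
    exact getD_le_getD hs.sorted h.le hi'.1
  · have := (map_snd_filter_inside_perm hs hy ha hZs hZ j).length_eq
    rw [insideRequests_eq hZr, insidePositions, List.length_map, List.length_map, ← this,
      List.length_map]

/-- DIVIDE outputs a perfect matching; its cost is that of `A` on the blocks and that of the optimal
matching on the marked requests. -/
theorem divideLog_perm_and_cost (hs : IsLine s k) (hy : IsPositions s ys)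
    (ha : Describes s k ys a) (hr : ys.Perm (r.map (trunc s)))
    (hZr : Z.map Prod.fst = labelLog s k a r)
    (hZs : (Z.map Prod.snd).Perm (List.range s.length))
    (hZ : ∀ z ∈ Z, ys.getD z.2 0 = trunc s z.1.pos ∧ pairLabel s k ys z.2 = z.1.label)
    (A : OnlineAlg) :
    ((divideLog A s k a r).map Served.server).Perm (List.range s.length) ∧
    cost s r ((divideLog A s k a r).map Served.server) =
      ∑ j ∈ Finset.Icc 1 k, cost (insidePositions s k a j) (insideRequests s k a r j)
        (A.run (insidePositions s k a j) (insideRequests s k a r j)) +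
      ((Z.filter fun z => decide (¬ z.1.label = Label.inside)).map
        fun z => |z.1.pos - s.getD z.2 0|).sum := by
  set E := divideLog A s k a r with hE
  have hrun : ∀ j, (A.run (insidePositions s k a j) (insideRequests s k a r j)).Perm
      (List.range (insideServers s k a j).length) := by
    intro j
    have := A.legal _ _ (isInput_inside hs hy ha hZr hZs hZ j)
    rwa [IsMatching, insidePositions, List.length_map] at this
  have hin : ∀ j, ((E.filter fun e => decide (e.IsInside s k j)).map Served.server).Perm
      (insideServers s k a j) := by
    intro j
    rw [map_server_inside]
    refine ((hrun j).map _).trans (List.Perm.of_eq ?_)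
    apply List.ext_getElem
    · simp
    · intro i h1 h2
      simp [h2]
  have hun : ∀ e ∈ E, e.label = Label.inside → e.server ∉ marked s k a := by
    intro e he hl
    have : e.server ∈ insideServers s k a (blockOf s k e.pos) := by
      refine (hin _).mem_iff.1 (List.mem_map_of_mem ?_)
      simp only [List.mem_filter, decide_eq_true_eq]
      exact ⟨he, hl, rfl⟩
    simp only [insideServers, List.mem_filter, decide_eq_true_eq] at this
    exact this.2.2.2
  have hmark := map_server_marked A s k a r hun
  have hbits : ((E.filter fun e => decide (¬ e.label = Label.inside)).map Served.bit) =
      ((Z.filter fun z => decide (¬ z.1.label = Label.inside)).map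
        fun z => (z.1.bit, z.2)).map Prod.fst := by
    have h1 : (E.filter fun e => decide (¬ e.label = Label.inside)).map Served.bit =
        ((labelLog s k a r).filter fun e => decide (¬ e.label = Label.inside)).map Served.bit := by
      rw [← map_erase_divideLog A s k a r, List.filter_map, List.map_map]
      rfl
    rw [h1, ← hZr, List.filter_map, List.map_map, List.map_map]
    rfl
  have hsnd : ((Z.filter fun z => decide (¬ z.1.label = Label.inside)).map
        fun z => (z.1.bit, z.2)).map Prod.snd =
      (Z.filter fun z => decide (¬ z.1.label = Label.inside)).map Prod.snd := by
    rw [List.map_map]; rfl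
  obtain ⟨hp, hc⟩ := lrRun_perm_and_cost hs.sorted (marked s k a) _
    (isDirected_filter_marked hs hy ha hr hZr hZs hZ)
    (by
      rw [hsnd]
      exact (hZs.nodup_iff.2 List.nodup_range).sublist (List.filter_sublist.map _))
    (by rw [hsnd]; exact toFinset_filter_marked hs hy ha hZs hZ)
    (fun j hj => ((mem_marked_iff hs hy ha j).1 hj).1)
  rw [← hbits, ← hmark] at hp hc
  rw [hsnd] at hp
  have hblk : ∀ x, blockOf s k x ∈ Finset.Icc 1 k := fun x =>
    Finset.mem_Icc.2 ⟨(IsLine.blockOf_spec hs.pos x).1, (IsLine.blockOf_spec hs.pos x).2.1⟩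
  constructor
  · refine List.Perm.trans ?_ hZs
    rw [← Multiset.coe_eq_coe]
    -- Written as a sum of singletons in the monoid of multisets, a list of servers splits by the
    -- same lemma as the cost.
    have h1 : ∀ {α : Type} (l : List α) (f : α → ℕ),
        ((l.map f : List ℕ) : Multiset ℕ) = (l.map fun a => ({f a} : Multiset ℕ)).sum := by
      intro α l f
      induction l with
      | nil => rfl
      | cons a l ih => rw [List.map_cons, List.map_cons, List.sum_cons, ← ih]; rfl
    rw [h1, h1, sum_map_eq_sum_blocks E _ (fun e => e.label = Label.inside)
      (fun e => blockOf s k e.pos) k (fun e _ => hblk _),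
      sum_map_eq_sum_blocks Z _ (fun z => z.1.label = Label.inside)
      (fun z => blockOf s k z.1.pos) k (fun z _ => hblk _)]
    simp only [← h1]
    congr 1
    · refine Finset.sum_congr rfl fun j _ => ?_
      exact Multiset.coe_eq_coe.2 ((hin j).trans
        (map_snd_filter_inside_perm hs hy ha hZs hZ j).symm)
    · exact Multiset.coe_eq_coe.2 hp
  · have hcost : cost s r (E.map Served.server) =
        (E.map fun e => |e.pos - s.getD e.server 0|).sum := by
      conv_lhs => rw [← map_pos_divideLog A s k a r]
      exact cost_map_map _ _ _ _
    rw [hcost, sum_map_eq_sum_blocks E _ (fun e => e.label = Label.inside)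
      (fun e => blockOf s k e.pos) k (fun e _ => hblk _)]
    congr 1
    · refine Finset.sum_congr rfl fun j _ => ?_
      rw [insidePositions, cost_map_getD, ← insidePositions, ← map_server_inside,
        ← map_pos_filter_divideLog A, cost_map_map]
      · rfl
      · exact fun i hi => List.mem_range.1 ((hrun j).mem_iff.1 hi)
    · rw [List.zipWith_map, List.zipWith_self, List.map_map] at hc
      exact hc

end

/-! ### Competitive algorithms -/

theorem exists_abs_getD_le (s : List ℝ) : ∃ M, ∀ j, |s.getD j 0| ≤ M := by
  refine ⟨(s.map abs).sum, fun j => ?_⟩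
  have h0 : ∀ x ∈ s.map abs, (0 : ℝ) ≤ x := by
    intro x hx
    obtain ⟨y, -, rfl⟩ := List.mem_map.1 hx
    exact abs_nonneg y
  by_cases hj : j < s.length
  · rw [List.getD_eq_getElem _ _ hj]
    exact List.single_le_sum h0 _ (List.mem_map_of_mem (List.getElem_mem hj))
  · rw [List.getD_eq_default _ _ (not_lt.1 hj), abs_zero]
    exact List.sum_nonneg h0

open MeasureTheory in
-- The cost is a finite sum of bounded measurable functions of the decisions. Measurability is
-- available only while fewer requests than servers have arrived, which is why `h` is needed.
theorem integrable_cost_run {Ω : Type*} [MeasurableSpace Ω] (μ : Measure Ω) [IsFiniteMeasure μ]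
    {A : Ω → OnlineAlg} (hA : IsRandomized A) (s r : List ℝ) (h : r.length ≤ s.length) :
    Integrable (fun ω => cost s r ((A ω).run s r)) μ := by
  induction r using List.reverseRecOn with
  | nil => simp [cost]
  | append_singleton r x ih =>
    rw [List.length_append, List.length_singleton] at h
    have h1 : (fun ω => cost s (r ++ [x]) ((A ω).run s (r ++ [x]))) =
        fun ω => cost s r ((A ω).run s r) + |x - s.getD ((A ω).serve s r x) 0| := by
      funext ω
      simp only [OnlineAlg.run, runServe_append, cost]
      rw [List.zipWith_append (by simp [runServe])]
      simp
    rw [h1]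
    refine (ih (by omega)).add ?_
    obtain ⟨M, hM⟩ := exists_abs_getD_le s
    have hmeas : Measurable fun ω => |x - s.getD ((A ω).serve s r x) 0| :=
      (measurable_of_countable fun j : ℕ => |x - s.getD j 0|).comp (hA s r x (by omega))
    refine Integrable.of_bound hmeas.aestronglyMeasurable (|x| + M) (Filter.Eventually.of_forall ?_)
    intro ω
    rw [Real.norm_eq_abs, abs_abs]
    exact (abs_sub _ _).trans (add_le_add le_rfl (hM _))

open MeasureTheory in
theorem IsCompetitive.additive_nonneg {Ω : Type*} [MeasurableSpace Ω] {μ : Measure Ω}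
    {A : Ω → OnlineAlg} {c : ℕ → ℝ} {α : ℝ} (h : IsCompetitive μ A c α) : 0 ≤ α := by
  have h1 := h [] [] ⟨List.Pairwise.nil, rfl⟩
  have h2 : opt [] [] = 0 := le_antisymm
    ((opt_le_cost (s := []) (σ := []) (List.Perm.refl (List.range 0))).trans (by simp [cost]))
    (opt_nonneg _ _)
  simpa [cost, h2] using h1

theorem cost_replicate {m : ℕ} {M : ℝ} (hM : 0 ≤ M) {σ : List ℕ} (hσ : IsMatching m σ) :
    cost (List.replicate m 0) (List.replicate m M) σ = m * M := by
  have hlen : σ.length = m := by simpa using hσ.length_eq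
  have h1 : List.zipWith (fun x j => |x - (List.replicate m (0 : ℝ)).getD j 0|)
      (List.replicate m M) σ = List.replicate m M := by
    apply List.ext_getElem
    · simp [hlen]
    · intro i h1 h2
      have h3 : ∀ j, (List.replicate m (0 : ℝ)).getD j 0 = 0 := by
        intro j
        by_cases hj : j < m
        · rw [List.getD_eq_getElem _ _ (by simpa using hj)]; simp
        · rw [List.getD_eq_default _ _ (by simpa using hj)]
      rw [List.getElem_zipWith, h3]
      simp [abs_of_nonneg hM]
  rw [cost, h1]
  simp

open MeasureTheory in
-- With `m` servers at `0` and `m` requests at `M` every matching costs `m * M`, and for large `M`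
-- the additive constant cannot make up for a ratio below `1`. The bound serves to absorb the cost
-- of the marked requests.
theorem IsCompetitive.one_le {Ω : Type*} [MeasurableSpace Ω] {μ : Measure Ω}
    [IsProbabilityMeasure μ] {A : Ω → OnlineAlg} {c : ℕ → ℝ} {α : ℝ}
    (h : IsCompetitive μ A c α) {m : ℕ} (hm : 1 ≤ m) : 1 ≤ c m := by
  by_contra! hc
  have hα := h.additive_nonneg
  -- With this choice `M * (1 - c m) = α + 1`, which exceeds `α` already for `m = 1`.
  set M : ℝ := (α + 1) / (1 - c m) with hMdef
  have hM : 0 ≤ M := div_nonneg (by linarith) (by linarith)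
  have hin : IsInput (List.replicate m (0 : ℝ)) (List.replicate m M) :=
    ⟨by rw [List.pairwise_replicate]; exact Or.inr le_rfl, by simp⟩
  have h1 := h _ _ hin
  have h2 : ∀ ω, cost (List.replicate m 0) (List.replicate m M)
      ((A ω).run (List.replicate m 0) (List.replicate m M)) = m * M := fun ω =>
    cost_replicate hM (by simpa [OnlineAlg.run] using (A ω).legal _ _ hin)
  have h3 : opt (List.replicate m 0) (List.replicate m M) = m * M := by
    apply le_antisymm
    · refine (opt_le_cost (σ := List.range m) ?_).trans_eq (cost_replicate hM (List.Perm.refl _))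
      simp [IsMatching]
    · exact le_opt fun σ hσ => (cost_replicate hM (by simpa using hσ)).ge
  simp only [h2, h3, integral_const, List.length_replicate, probReal_univ, one_smul] at h1
  have hm' : (1 : ℝ) ≤ m := by exact_mod_cast hm
  have h4 : M * (1 - c m) = α + 1 := div_mul_cancel₀ _ (by linarith)
  nlinarith

/-! ### The theorem -/

theorem isLine_of_head_last {s : List ℝ} {k N : ℕ} (hs : s.Pairwise (· ≤ ·)) (hk : 0 < k)
    (hkn : k ≤ s.length) (hhead : s.head? = some 1) (hlast : s.getLast? = some ((N : ℝ) - 1)) :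
    IsLine s k ∧ span s = N ∧ 2 ≤ N := by
  have hn : 0 < s.length := by omega
  have h0 : s.getD 0 0 = 1 := by
    rw [List.head?_eq_getElem?] at hhead
    simp [List.getD, hhead]
  have hl : s.getD (s.length - 1) 0 = N - 1 := by
    rw [List.getLast?_eq_getElem?] at hlast
    simp [List.getD, hlast]
  have h1 := getD_le_getD hs (Nat.zero_le (s.length - 1)) (by omega)
  rw [h0, hl] at h1
  have hN : 2 ≤ N := by
    have : (2 : ℝ) ≤ N := by linarith
    exact_mod_cast this
  have hspan : span s = N := by
    rw [span, List.getLastD_eq_getLast?, hlast, Option.getD_some,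
      show (N : ℝ) - 1 = ((N - 1 : ℕ) : ℝ) by push_cast [show 1 ≤ N by omega]; ring,
      Nat.floor_natCast]
    omega
  refine ⟨⟨hs, hk, hkn, fun i hi => ?_, fun i hi => ?_⟩, hspan, hN⟩
  · rw [← h0]; exact getD_le_getD hs (Nat.zero_le i) hi
  · rw [hspan, ← hl]; exact getD_le_getD hs (by omega) (by omega)

theorem exists_isPositions {s r : List ℝ} (hr : r.length = s.length)
    (hreq : ∀ x ∈ r, ∃ z : ℤ, x = z) :
    ∃ ys : List ℝ, IsPositions s ys ∧ ys.Perm (r.map (trunc s)) := by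
  have hp := List.perm_insertionSort (· ≤ ·) (r.map (trunc s))
  refine ⟨_, ⟨List.pairwise_insertionSort (· ≤ ·) (r.map (trunc s)), ?_, ?_⟩, hp⟩
  · rw [hp.length_eq, List.length_map, hr]
  · intro t ht
    have hlen : t < ((r.map (trunc s)).insertionSort (· ≤ ·)).length := by
      rw [hp.length_eq, List.length_map, hr]; exact ht
    rw [List.getD_eq_getElem _ _ hlen]
    obtain ⟨x, hx, hxy⟩ := List.mem_map.1 (hp.mem_iff.1 (List.getElem_mem hlen))
    obtain ⟨z, rfl⟩ := hreq x hx
    rw [← hxy]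
    refine ⟨(max 0 (min (span s : ℤ) z)).toNat, by omega, ?_⟩
    have h1 : (((max 0 (min (span s : ℤ) z)).toNat : ℕ) : ℤ) = max 0 (min (span s : ℤ) z) :=
      Int.toNat_of_nonneg (le_max_left _ _)
    have h2 : (((max 0 (min (span s : ℤ) z)).toNat : ℕ) : ℝ) =
        ((max 0 (min (span s : ℤ) z) : ℤ) : ℝ) := by exact_mod_cast congrArg (Int.cast (R := ℝ)) h1
    rw [h2, trunc]
    push_cast
    rfl

open MeasureTheory in
-- With `C = c ⌈n/k⌉`, the subroutine pays in each block at most `C` times the cost of `Z` there,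
-- plus `α`, and the marked requests pay exactly what they pay in `Z`, which is at most `C` times
-- that since `C ≥ 1`. The whole cost of `Z` is at most the optimum.
theorem exists_tape_divide {k : ℕ} {Ω : Type*} [MeasurableSpace Ω]
    {μ : Measure Ω} [IsProbabilityMeasure μ] {A : Ω → OnlineAlg} (hA : IsRandomized A)
    {c : ℕ → ℝ} (hc : MonotoneOn c (Set.Ici 1)) {α : ℝ} (hcomp : IsCompetitive μ A c α)
    {s r : List ℝ} (hs : IsLine s k) (hr : r.length = s.length)
    (hreq : ∀ x ∈ r, ∃ z : ℤ, x = z) :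
    ∃ tape : ℕ → Bool,
      (∀ ω, IsMatching s.length (((divide k (A ω)).run s r).eval tape)) ∧
      Integrable (fun ω => cost s r (((divide k (A ω)).run s r).eval tape)) μ ∧
      ∫ ω, cost s r (((divide k (A ω)).run s r).eval tape) ∂μ ≤
        c ⌈(s.length : ℝ) / k⌉₊ * opt s r + k * α := by
  obtain ⟨ys, hy, hys⟩ := exists_isPositions hr hreq
  obtain ⟨tape, a, htape, ha⟩ := exists_tape_describes hs hy
  obtain ⟨Z, hZr, hZs, hZ⟩ := exists_matching_labelLog hs hy ha hys
  have key := fun ω => divideLog_perm_and_cost hs hy ha hys hZr hZs hZ (A ω)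
  have hinp := isInput_inside hs hy ha hZr hZs hZ
  refine ⟨tape, fun ω => ?_, ?_⟩
  · rw [eval_run_divide, htape]
    exact (key ω).1
  simp only [eval_run_divide, htape, fun ω => (key ω).2]
  have hsub : ∀ j ∈ Finset.Icc 1 k, Integrable (fun ω =>
      cost (insidePositions s k a j) (insideRequests s k a r j)
        ((A ω).run (insidePositions s k a j) (insideRequests s k a r j))) μ := fun j _ =>
    integrable_cost_run μ hA _ _ (hinp j).2.le
  have hsum := integrable_finsetSum (Finset.Icc 1 k) hsub
  refine ⟨hsum.add (integrable_const _), ?_⟩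
  rw [integral_add hsum (integrable_const _), integral_finsetSum _ hsub, integral_const,
    probReal_univ, one_smul]
  set C := c ⌈(s.length : ℝ) / k⌉₊ with hC
  have hn : 0 < s.length := hs.pos.trans_le hs.le_length
  have hceil : 1 ≤ ⌈(s.length : ℝ) / k⌉₊ := Nat.ceil_pos.2
    (div_pos (by exact_mod_cast hn) (by exact_mod_cast hs.pos))
  have hC1 : 1 ≤ C := hcomp.one_le hceil
  have hblock : ∀ j ∈ Finset.Icc 1 k, ∫ ω, cost (insidePositions s k a j)
      (insideRequests s k a r j)
        ((A ω).run (insidePositions s k a j) (insideRequests s k a r j)) ∂μ ≤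
      C * ((Z.filter fun z => decide (z.1.IsInside s k j)).map
        fun z => |z.1.pos - s.getD z.2 0|).sum + α := by
    intro j hj
    refine (hcomp _ _ (hinp j)).trans (add_le_add ?_ le_rfl)
    have hopt : opt (insidePositions s k a j) (insideRequests s k a r j) ≤
        ((Z.filter fun z => decide (z.1.IsInside s k j)).map
          fun z => |z.1.pos - s.getD z.2 0|).sum := by
      rw [insideRequests_eq hZr]
      exact opt_map_le s (List.nodup_range.filter _) _ (fun z => z.1.pos) Prod.snd
        (map_snd_filter_inside_perm hs hy ha hZs hZ j)
    have hnn := opt_nonneg (insidePositions s k a j) (insideRequests s k a r j)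
    -- Monotonicity of `c` starts at `1`, so a block without unmarked servers is treated apart: its
    -- optimum is `0`, whatever `c 0` may be.
    rcases Nat.eq_zero_or_pos (insidePositions s k a j).length with h0 | hpos
    · have h2 : opt (insidePositions s k a j) (insideRequests s k a r j) = 0 := by
        refine le_antisymm ((opt_le_cost (σ := []) ?_).trans ?_) hnn
        · rw [h0]; exact List.Perm.refl _
        · simp [cost]
      rw [h2, mul_zero]
      exact mul_nonneg (by linarith) (hnn.trans hopt)
    · have hle : (insidePositions s k a j).length ≤ ⌈(s.length : ℝ) / k⌉₊ := by
        refine le_trans ?_ (blockEnd_sub_le hs.pos (Finset.mem_Icc.1 hj).1)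
        rw [insidePositions, List.length_map, ← Nat.card_Ico (blockEnd s.length k (j - 1)),
          insideServers,
          ← List.toFinset_card_of_nodup (List.nodup_range.filter _)]
        apply Finset.card_le_card
        intro i hi
        simp only [List.mem_toFinset, List.mem_filter, decide_eq_true_eq] at hi
        exact Finset.mem_Ico.2 ⟨hi.2.1, hi.2.2.1⟩
      exact (mul_le_mul_of_nonneg_right (hc hpos hceil hle) hnn).trans
        (mul_le_mul_of_nonneg_left hopt (by linarith))
  have hZopt := sum_le_opt hs hy hys Z (by
    rw [← map_pos_labelLog s k a r, ← hZr, List.map_map]; rfl) hZs (fun z hz => (hZ z hz).1)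
  rw [sum_map_eq_sum_blocks Z _ (fun z => z.1.label = Label.inside)
    (fun z => blockOf s k z.1.pos) k (fun z _ => Finset.mem_Icc.2
      ⟨(IsLine.blockOf_spec hs.pos _).1, (IsLine.blockOf_spec hs.pos _).2.1⟩)] at hZopt
  set B := ((Z.filter fun z => decide (¬ z.1.label = Label.inside)).map
    fun z => |z.1.pos - s.getD z.2 0|).sum with hB
  have hB0 : 0 ≤ B := by
    apply List.sum_nonneg
    intro x hx
    obtain ⟨z, -, rfl⟩ := List.mem_map.1 hx
    exact abs_nonneg _
  have h1 := Finset.sum_le_sum hblock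
  rw [Finset.sum_add_distrib, Finset.sum_const, Nat.card_Icc, Nat.add_sub_cancel, nsmul_eq_mul,
    ← Finset.mul_sum] at h1
  have h2 := mul_le_mul_of_nonneg_left hZopt (show 0 ≤ C by linarith)
  have h3 : B ≤ C * B := le_mul_of_one_le_left hB0 hC1
  rw [mul_add] at h2
  have h4 : ∀ j, (Z.filter fun z => decide (z.1.IsInside s k j)) =
      Z.filter fun z => decide (z.1.label = Label.inside ∧ blockOf s k z.1.pos = j) := fun _ => rfl
  simp only [h4] at h1
  linarith

end LineMatching

end

open MeasureTheory LineMatching in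
theorem mainTheorem3 :
    ∃ C : ℝ, ∀ (k : ℕ), 0 < k →
      ∀ (Ω : Type*) [MeasurableSpace Ω] (μ : Measure Ω) [IsProbabilityMeasure μ]
        (A : Ω → OnlineAlg), IsRandomized A →
      ∀ (c : ℕ → ℝ), MonotoneOn c (Set.Ici 1) →
      ∀ (α : ℝ), IsCompetitive μ A c α →
      ∀ (n N : ℕ) (s r : List ℝ), IsInput s r → s.length = n → k ≤ n →
        s.head? = some 1 → s.getLast? = some ((N : ℝ) - 1) → (∀ x ∈ r, ∃ z : ℤ, x = z) →
        (∀ (ω : Ω) (tape : ℕ → Bool),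
          (((divide k (A ω)).run s r).bits tape : ℝ) ≤
            C * (k * (Real.logb 2 N + Real.logb 2 n))) ∧
        ∃ tape : ℕ → Bool,
          (∀ ω, IsMatching n (((divide k (A ω)).run s r).eval tape)) ∧
          Integrable (fun ω => cost s r (((divide k (A ω)).run s r).eval tape)) μ ∧
          ∫ ω, cost s r (((divide k (A ω)).run s r).eval tape) ∂μ ≤
            c ⌈(n : ℝ) / k⌉₊ * opt s r + k * α := by
  -- With `a = log₂ N` and `b = log₂ n` the words read amount to at most `2 (a + 1) + 4 (b + 1) = 2
  -- a + 4 b + 6` bits for each of `k - 1` blocks. Since `N ≥ 2`, `a ≥ 1`, and the `6` is absorbed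
  -- into `6 a`.
  refine ⟨8, ?_⟩
  rintro k hk Ω _ μ _ A hA c hc α hcomp n N s r ⟨hsort, hlen⟩ rfl hkn hhead hlast hreq
  obtain ⟨hs, hspan, hN⟩ := isLine_of_head_last hsort hk hkn hhead hlast
  refine ⟨fun ω tape => ?_, exists_tape_divide hA hc hcomp hs hlen hreq⟩
  have h1 := bits_run_divide_le k (A ω) s r tape
  rw [hspan] at h1
  have h2 : (((divide k (A ω)).run s r).bits tape : ℝ) ≤
      ((k - 1 : ℕ) : ℝ) * (2 * ((Nat.log 2 N : ℝ) + 1) + 4 * ((Nat.log 2 s.length : ℝ) + 1)) := by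
    exact_mod_cast h1
  have hk1 : ((k - 1 : ℕ) : ℝ) ≤ k := by exact_mod_cast Nat.sub_le k 1
  have h3 : (Nat.log 2 N : ℝ) ≤ Real.logb 2 N := by exact_mod_cast Real.natLog_le_logb N 2
  have h4 : (Nat.log 2 s.length : ℝ) ≤ Real.logb 2 s.length := by
    exact_mod_cast Real.natLog_le_logb s.length 2
  have h5 : (1 : ℝ) ≤ Real.logb 2 N := by
    rw [Real.le_logb_iff_rpow_le (by norm_num) (by positivity)]
    simpa using (by exact_mod_cast hN : (2 : ℝ) ≤ N)
  have h6 : (0 : ℝ) ≤ Real.logb 2 s.length :=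
    Real.logb_nonneg (by norm_num) (by exact_mod_cast hk.trans_le hkn)
  calc (((divide k (A ω)).run s r).bits tape : ℝ)
      ≤ k * (2 * (Real.logb 2 N + 1) + 4 * (Real.logb 2 s.length + 1)) := by
        refine h2.trans ?_
        gcongr
    _ ≤ k * (8 * (Real.logb 2 N + Real.logb 2 s.length)) := by
        gcongr
        linarith
    _ = 8 * (k * (Real.logb 2 N + Real.logb 2 s.length)) := by ring
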